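/- A nondeterministic discounted-sum automaton with discount factor $\lambda$ (a $\lambda$-NDA), where $\lambda\in\mathbb{Q}\cap(1,\infty)$, consists of a finite alphabet $\Sigma$, a finite set of states $Q$, a set of initial states $\iota\subseteq Q$, a set of transitions $\delta\subseteq Q\times\Sigma\times Q$, and a weight function $\gamma:\delta\to\mathbb{Q}$. A run on a finite word $u=\sigma_0\cdots\sigma_{n-1}$ is a sequence of states $p_0,\dots,p_n$ with $p_0\in\iota$ and $(p_i,\sigma_i,p_{i+1})\in\delta$ for all $i<n$; its value is $\sum_{i=0}^{n-1}\gamma(p_i,\sigma_i,p_{i+1})\,\lambda^{-i}$. The value $\mathcal{A}(u)$ of an NDA $\mathcal{A}$ on $u$ is the infimum of the values of its runs on $u$ (so $\mathcal{A}(u)=+\infty$ if there is no run). An NDA is deterministic (a $\lambda$-DDA) if $|\iota|=1$ and for every $q\in Q$ and $\sigma\in\Sigma$ there is at most one $q'$ with $(q,\sigma,q')\in\delta$. **Lemma.** There is an algorithm that, given rational discount factors $\lambda_A,\lambda_D>1$, a $\lambda_A$-NDA $\mathcal{A}$ and a $\lambda_D$-DDA $\mathcal{D}$ over the same finite alphabet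 $\Sigma$, computes the exact value of $$\inf\{\mathcal{A}(u)-\mathcal{D}(u) : u\in\Sigma^+\},$$ and determines whether there is a word $u\in\Sigma^+$ for which $\mathcal{A}(u)-\mathcal{D}(u)$ equals that value. Here words on which neither automaton has a run (where the difference would be $\infty-\infty$) are disregarded, differences are taken in $\mathbb{R}\cup\{\pm\infty\}$, and $\inf\emptyset=+\infty$; the algorithm outputs the infimum as $-\infty$, $+\infty$, or a fraction of two integers. In particular, no word is disregarded when both automata have a run on every word. -/

import Mathlib

/-- A nondeterministic discounted-sum automaton on finite words over the alphabet `σ` with state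
set `Q`: initial states, a transition relation, rational weights on the transitions, and one
rational discount factor greater than one. With discount factor `l` it is an `l`-NDA. Totality is
not required: a word may have no run. -/
structure NDA (σ Q : Type*) where
  init : Set Q
  trans : Set (Q × σ × Q)
  weight : trans → ℚ
  discount : ℚ
  one_lt_discount : 1 < discount

namespace NDA

variable {σ Q : Type*}

/-- A run of `A` on the finite word `u = a₀ a₁ ⋯ aₙ₋₁`: states `p₀, p₁, …, pₙ` such that `p₀` is
initial and every `(pᵢ, aᵢ, pᵢ₊₁)` is a transition. -/
structure Run (A : NDA σ Q) (u : List σ) where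
  state : Fin (u.length + 1) → Q
  start : state 0 ∈ A.init
  step : ∀ i : Fin u.length, (state i.castSucc, u.get i, state i.succ) ∈ A.trans

/-- The discounted sum `∑ᵢ γ(pᵢ, aᵢ, pᵢ₊₁) / λ ^ i` of a run. -/
def Run.value {A : NDA σ Q} {u : List σ} (r : A.Run u) : ℚ :=
  ∑ i : Fin u.length, A.weight ⟨_, r.step i⟩ / A.discount ^ (i : ℕ)

/-- The value of `A` on a word: the infimum of the values of its runs on the word, which is `⊤`
if there is no run. -/
noncomputable def value (A : NDA σ Q) (u : List σ) : EReal :=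
  ⨅ r : A.Run u, ((r.value : ℝ) : EReal)

/-- Exactly one initial state, and at most one transition per state and letter. -/
def IsDeterministic (A : NDA σ Q) : Prop :=
  (∃! q, q ∈ A.init) ∧
    ∀ q a q₁ q₂, (q, a, q₁) ∈ A.trans → (q, a, q₂) ∈ A.trans → q₁ = q₂

/-- The set of all `A(u) - D(u)`, where `u` ranges over the nonempty finite words for which this
difference is defined. It is undefined exactly when neither automaton has a run on `u`
(it would read `∞ - ∞`). -/
def diffSet {Q' : Type*} (A : NDA σ Q) (D : NDA σ Q') : Set EReal :=
  {x | ∃ u : List σ, u ≠ [] ∧ (Nonempty (A.Run u) ∨ Nonempty (D.Run u)) ∧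
    x = A.value u - D.value u}

end NDA

/-- A rational number as finite data: its reduced numerator and denominator. -/
def ratCode (q : ℚ) : ℤ × ℕ := (q.num, q.den)

/-- Finite data describing an automaton: discount factor, number of states, list of initial
states, list of transitions with their weights. -/
abbrev NDACode : Type :=
  (ℤ × ℕ) × ℕ × List ℕ × List ((ℕ × ℕ × ℕ) × (ℤ × ℕ))

open Classical in
/-- The description of an automaton with states `0, …, n - 1` over the letters `0, …, m - 1`. -/
noncomputable def NDA.code {m n : ℕ} (A : NDA (Fin m) (Fin n)) : NDACode :=
  (ratCode A.discount, n,
    ((List.finRange n).filter (fun q => q ∈ A.init)).map (fun q => (q : ℕ)),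
    (List.finRange n ×ˢ (List.finRange m ×ˢ List.finRange n)).filterMap fun t =>
      if h : t ∈ A.trans then
        some (((t.1 : ℕ), (t.2.1 : ℕ), (t.2.2 : ℕ)), ratCode (A.weight ⟨t, h⟩))
      else none)

/-- `Denotes c x`: the finite datum `c` is a name of the extended real number `x`, which is `-∞`,
`+∞` or a fraction with nonzero denominator. -/
def Denotes : Option (Option (ℤ × ℕ)) → EReal → Prop
  | none, x => x = ⊥
  | some none, x => x = ⊤
  | some (some (a, b)), x => b ≠ 0 ∧ x = (((a : ℝ) / (b : ℝ) : ℝ) : EReal)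

/-!
The algorithm searches for a finite certificate of the answer and stops when a primitive recursive
test accepts one (`exists_computable_of_certificate`). It therefore suffices that every accepted
certificate is right (`NDA.accepts_sound`) and that one always exists (`NDACode.exists_accepts`).

Since `D` is deterministic, the differences `A(u) - D(u)` are governed by the walks of the
synchronous product, in which a step at time `n` with weights `a` and `d` costs
`a * α ^ n - d * β ^ n`, where `α` and `β` are the inverses of the two discount factors
(`NDA.IsProduct.walk_iff`). If along some reachable pair `A` can move on a letter on which `D` is
stuck, then the infimum is `-∞` and attained. If `A` has no transition from an initial state, then
all differences are `+∞`. Otherwise the infimum is that of the costs of the nonempty walks.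

The heart of the matter is the shape of the optimal continuation of a walk from time `n` on. Unless
`α = β`, the larger of `α` and `β` dominates for large `n`, and the other one only breaks ties;
in any case one memoryless strategy is optimal at all large times, because two exponential sums
`α ^ n * x - β ^ n * y` eventually compare in one and the same way
(`eventually_pow_mul_trichotomy`). Among the finitely many memoryless strategies, take one whose
total cost over all states is eventually minimal. Switching its action at a single state cannot
improve it, so it satisfies the Bellman equation (`exists_potential`). Its costs are exponential
sums with rational coefficients, which solve a linear system (`exists_policy_value`).

A certificate (`CostGraph.IsCertificate`) consists of a time `N` and of such potentials for the
reachable states. Up to time `N` all walks are enumerated; from then on the potentials bound the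
costs from below. If the infimum is attained, an attaining walk shows that the bound is sharp. If
not, a flag marks the states whose potential is approached but never attained: optimal steps from
such a state lead to such states only, and following them the potential tends to zero. That the
inequalities hold at all times from `N` on is a finite test (`pow_mul_le_pow_mul_iff`).
-/

/-! ### Exponential sums and optimal memoryless strategies -/

section

open Filter Topology

/-- An inequality between two exponential sequences holds from time `N` on if and only if it holds
at time `N` and the coefficient of the dominant base has the right sign. -/
theorem pow_mul_le_pow_mul_iff {α β : ℚ} (hα : 0 < α) (hβ : 0 < β) {N : ℕ} {R S : ℚ} :
    (∀ n ≥ N, β ^ n * S ≤ α ^ n * R) ↔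
      β ^ N * S ≤ α ^ N * R ∧ (β ≤ α ∧ 0 ≤ R ∨ α ≤ β ∧ S ≤ 0) := by
  constructor
  · intro h
    refine ⟨h N le_rfl, ?_⟩
    rcases lt_trichotomy β α with hlt | rfl | hgt
    · refine Or.inl ⟨hlt.le, ?_⟩
      have ht : Tendsto (fun n : ℕ => (β / α) ^ n * S) atTop (𝓝 0) := by
        simpa using (tendsto_pow_atTop_nhds_zero_of_lt_one (by positivity)
          ((div_lt_one hα).2 hlt)).mul_const S
      refine le_of_tendsto ht (eventually_atTop.2 ⟨N, fun n hn => ?_⟩)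
      have := h n hn
      rw [div_pow, div_mul_eq_mul_div, div_le_iff₀ (by positivity)]
      linarith
    · rcases le_total 0 R with hR | hR
      · exact Or.inl ⟨le_rfl, hR⟩
      · exact Or.inr ⟨le_rfl, (le_of_mul_le_mul_left (h N le_rfl) (by positivity)).trans hR⟩
    · refine Or.inr ⟨hgt.le, ?_⟩
      have ht : Tendsto (fun n : ℕ => (α / β) ^ n * R) atTop (𝓝 0) := by
        simpa using (tendsto_pow_atTop_nhds_zero_of_lt_one (by positivity)
          ((div_lt_one hβ).2 hgt)).mul_const R
      refine ge_of_tendsto ht (eventually_atTop.2 ⟨N, fun n hn => ?_⟩)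
      have := h n hn
      rw [div_pow, div_mul_eq_mul_div, le_div_iff₀ (by positivity)]
      linarith
  · rintro ⟨hN, h⟩ n hn
    obtain ⟨k, rfl⟩ := Nat.exists_eq_add_of_le' hn
    rw [pow_add, pow_add, mul_assoc, mul_assoc]
    rcases h with ⟨hle, hR⟩ | ⟨hle, hS⟩
    · exact (mul_le_mul_of_nonneg_left hN (by positivity)).trans
        (mul_le_mul_of_nonneg_right (pow_le_pow_left₀ hβ.le hle k) (by positivity))
    · refine le_trans ?_ (mul_le_mul_of_nonneg_left hN (by positivity))
      exact mul_le_mul_of_nonpos_right (pow_le_pow_left₀ hα.le hle k)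
        (mul_nonpos_of_nonneg_of_nonpos (by positivity) hS)

/-- A weak inequality between exponential sequences that is strict at time `N` stays strict. -/
theorem pow_mul_lt_pow_mul_of_not_le {α β : ℚ} (hα : 0 < α) (hβ : 0 < β) {N : ℕ} {R S : ℚ}
    (h : ∀ n ≥ N, β ^ n * S ≤ α ^ n * R) (hN : ¬ α ^ N * R ≤ β ^ N * S) :
    ∀ n ≥ N, β ^ n * S < α ^ n * R := by
  intro n hn
  obtain ⟨-, h⟩ := (pow_mul_le_pow_mul_iff hα hβ).1 h
  push Not at hN
  obtain ⟨k, rfl⟩ := Nat.exists_eq_add_of_le' hn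
  rw [pow_add, pow_add, mul_assoc, mul_assoc]
  rcases h with ⟨hle, hR⟩ | ⟨hle, hS⟩
  · exact (mul_lt_mul_of_pos_left hN (by positivity)).trans_le
      (mul_le_mul_of_nonneg_right (pow_le_pow_left₀ hβ.le hle k) (by positivity))
  · refine lt_of_le_of_lt ?_ (mul_lt_mul_of_pos_left hN (by positivity))
    exact mul_le_mul_of_nonpos_right (pow_le_pow_left₀ hα.le hle k)
      (mul_nonpos_of_nonneg_of_nonpos (by positivity) hS)

/-- Two exponential sequences eventually compare in one and the same way. -/
theorem eventually_pow_mul_trichotomy {α β : ℚ} (hα : 0 < α) (hβ : 0 < β) (R S : ℚ) :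
    (∀ᶠ n : ℕ in atTop, β ^ n * S < α ^ n * R) ∨ (∀ᶠ n : ℕ in atTop, β ^ n * S = α ^ n * R) ∨
      (∀ᶠ n : ℕ in atTop, α ^ n * R < β ^ n * S) := by
  wlog hle : β ≤ α generalizing α β R S
  · rcases this hβ hα S R (le_of_not_ge hle) with h | h | h
    · exact Or.inr (Or.inr h)
    · exact Or.inr (Or.inl (h.mono fun n hn => hn.symm))
    · exact Or.inl h
  rcases hle.eq_or_lt with rfl | hlt
  · rcases lt_trichotomy S R with h | rfl | h
    · exact Or.inl (.of_forall fun n => mul_lt_mul_of_pos_left h (by positivity))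
    · exact Or.inr (Or.inl (.of_forall fun n => rfl))
    · exact Or.inr (Or.inr (.of_forall fun n => mul_lt_mul_of_pos_left h (by positivity)))
  have ht : Tendsto (fun n : ℕ => (β / α) ^ n * S) atTop (𝓝 0) := by
    simpa using (tendsto_pow_atTop_nhds_zero_of_lt_one (by positivity)
      ((div_lt_one hα).2 hlt)).mul_const S
  rcases lt_trichotomy R 0 with h | rfl | h
  · refine Or.inr (Or.inr ((ht.eventually (lt_mem_nhds h)).mono fun n hn => ?_))
    rw [div_pow, div_mul_eq_mul_div, lt_div_iff₀ (by positivity)] at hn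
    linarith
  · rcases lt_trichotomy S 0 with h | rfl | h
    · exact Or.inl (.of_forall fun n => by
        simpa using mul_neg_of_pos_of_neg (pow_pos hβ n) h)
    · exact Or.inr (Or.inl (.of_forall fun n => by simp))
    · exact Or.inr (Or.inr (.of_forall fun n => by simpa using mul_pos (pow_pos hβ n) h))
  · refine Or.inl ((ht.eventually (gt_mem_nhds h)).mono fun n hn => ?_)
    rw [div_pow, div_mul_eq_mul_div, div_lt_iff₀ (by positivity)] at hn
    linarith

/-- The discounted value of a memoryless strategy is rational: it solves a linear system over `ℚ`
whose matrix is injective because the discount factor is a contraction. -/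
theorem exists_policy_value {V : Type*} [Finite V] {γ : ℚ} (h0 : 0 < γ) (h1 : γ < 1)
    (π : V → Option (V × ℚ)) :
    ∃ X : V → ℚ, ∀ q, X q = (π q).elim 0 fun e => e.2 + γ * X e.1 := by
  cases nonempty_fintype V
  let L : (V → ℚ) →ₗ[ℚ] (V → ℚ) :=
    { toFun := fun X q => X q - (π q).elim 0 fun e => γ * X e.1
      map_add' := fun X Y => by
        ext q
        cases h : π q <;> (simp [h]; try ring)
      map_smul' := fun c X => by
        ext q
        cases h : π q <;> (simp [h]; try ring) }
  have hinj : Function.Injective L := by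
    refine (injective_iff_map_eq_zero L).2 fun X hX => ?_
    cases isEmpty_or_nonempty V
    · exact Subsingleton.elim _ _
    obtain ⟨q, hq⟩ := Finite.exists_max fun q => |X q|
    have hz : |X q| ≤ γ * |X q| := by
      have := congrFun hX q
      simp only [L, LinearMap.coe_mk, AddHom.coe_mk, Pi.zero_apply, sub_eq_zero] at this
      cases h : π q with
      | none => rw [h] at this; simp at this; simp [this]
      | some e =>
        rw [h] at this
        simp only [Option.elim_some] at this
        calc |X q| = γ * |X e.1| := by rw [this, abs_mul, abs_of_pos h0]
          _ ≤ γ * |X q| := mul_le_mul_of_nonneg_left (hq _) h0.le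
    have hz' : |X q| = 0 := le_antisymm (by nlinarith [abs_nonneg (X q)]) (abs_nonneg _)
    ext p
    exact abs_nonpos_iff.1 ((hq p).trans hz'.le)
  obtain ⟨X, hX⟩ := LinearMap.injective_iff_surjective.1 hinj fun q => (π q).elim 0 fun e => e.2
  refine ⟨X, fun q => ?_⟩
  have := congrFun hX q
  simp only [L, LinearMap.coe_mk, AddHom.coe_mk] at this
  cases h : π q with
  | none => simpa [h] using this
  | some e =>
    simp only [h, Option.elim_some] at this ⊢
    linarith

/-- A finite family of sequences whose pairwise comparisons are eventually constant has an
eventually minimal member. -/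
theorem exists_eventually_min {ι : Type*} [Finite ι] [Nonempty ι] (F : ι → ℕ → ℚ)
    (hF : ∀ i j, (∀ᶠ n in atTop, F i n ≤ F j n) ∨ ∀ᶠ n in atTop, F j n ≤ F i n) :
    ∃ i, ∀ j, ∀ᶠ n in atTop, F i n ≤ F j n := by
  cases nonempty_fintype ι
  suffices ∀ s : Finset ι, s.Nonempty → ∃ i ∈ s, ∀ j ∈ s, ∀ᶠ n in atTop, F i n ≤ F j n by
    obtain ⟨i, -, hi⟩ := this Finset.univ Finset.univ_nonempty
    exact ⟨i, fun j => hi j (Finset.mem_univ j)⟩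
  intro s hs
  induction hs using Finset.Nonempty.cons_induction with
  | singleton a => exact ⟨a, by simp⟩
  | cons a s ha hs ih =>
    obtain ⟨i, his, hi⟩ := ih
    rcases hF a i with h | h
    · refine ⟨a, by simp, fun j hj => ?_⟩
      rcases Finset.mem_cons.1 hj with rfl | hj
      · exact .of_forall fun n => le_rfl
      · filter_upwards [h, hi j hj] with n h1 h2 using h1.trans h2
    · refine ⟨i, by simp [his], fun j hj => ?_⟩
      rcases Finset.mem_cons.1 hj with rfl | hj
      · exact h
      · exact hi j hj

/-- The exponential sum with coefficients `c` at time `n`, discounted to time `0`. It serves both as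
the cost of a step with weights `c` and as the potential of a state with coefficients `c`. -/
def pot (α β : ℚ) (n : ℕ) (c : ℚ × ℚ) : ℚ := α ^ n * c.1 - β ^ n * c.2

theorem pot_sub (α β : ℚ) (n : ℕ) (c d : ℚ × ℚ) :
    pot α β n (c - d) = pot α β n c - pot α β n d := by
  simp only [pot, Prod.fst_sub, Prod.snd_sub]; ring

theorem pot_sum {ι : Type*} [Fintype ι] (α β : ℚ) (n : ℕ) (c : ι → ℚ × ℚ) :
    ∑ i, pot α β n (c i) = pot α β n (∑ i, c i) := by
  simp only [pot, Prod.fst_sum, Prod.snd_sum, Finset.sum_sub_distrib, Finset.mul_sum]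

theorem tendsto_pot {α β : ℚ} (hα : 0 < α) (hα' : α < 1) (hβ : 0 < β) (hβ' : β < 1) (c : ℚ × ℚ) :
    Tendsto (fun n => pot α β n c) atTop (𝓝 0) := by
  have h1 := (tendsto_pow_atTop_nhds_zero_of_lt_one hα.le hα').mul_const c.1
  have h2 := (tendsto_pow_atTop_nhds_zero_of_lt_one hβ.le hβ').mul_const c.2
  simpa [pot] using h1.sub h2

/-- The coefficients of the cost of a step with weights `w` followed by the potential of a state
with coefficients `c`, which is evaluated one time unit later. -/
def pullback (α β : ℚ) (w c : ℚ × ℚ) : ℚ × ℚ := (w.1 + α * c.1, w.2 + β * c.2)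

theorem pot_pullback (α β : ℚ) (n : ℕ) (w c : ℚ × ℚ) :
    pot α β n (pullback α β w c) = pot α β n w + pot α β (n + 1) c := by
  simp only [pot, pullback]; ring

/-- Solution of the Bellman equation for large times: at every state one may stop or take one of
finitely many actions, and the optimal costs are exponential sums with rational coefficients. -/
theorem exists_potential {V : Type*} [Finite V] {α β : ℚ} (hα : 0 < α) (hα' : α < 1)
    (hβ : 0 < β) (hβ' : β < 1) (act : V → Set (V × ℚ × ℚ)) (hact : ∀ q, (act q).Finite) :
    ∃ Z : V → ℚ × ℚ,
      (∀ q, ∀ᶠ n in atTop, pot α β n (Z q) ≤ 0) ∧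
      (∀ q, ∀ e ∈ act q, ∀ᶠ n in atTop, pot α β n (Z q) ≤ pot α β n (pullback α β e.2 (Z e.1))) ∧
      ∀ q, Z q = 0 ∨ ∃ e ∈ act q, Z q = pullback α β e.2 (Z e.1) := by
  classical
  cases nonempty_fintype V
  have := fun q => (hact q).to_subtype
  -- The value of every memoryless strategy.
  have hval (π : ∀ q, Option (act q)) : ∃ Z : V → ℚ × ℚ, ∀ q,
      Z q = (π q).elim 0 fun e => pullback α β e.1.2 (Z e.1.1) := by
    obtain ⟨X, hX⟩ := exists_policy_value hα hα' fun q => (π q).map fun e => (e.1.1, e.1.2.1)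
    obtain ⟨Y, hY⟩ := exists_policy_value hβ hβ' fun q => (π q).map fun e => (e.1.1, e.1.2.2)
    refine ⟨fun q => (X q, Y q), fun q => ?_⟩
    have h1 := hX q
    have h2 := hY q
    cases h : π q with
    | none =>
      rw [h] at h1 h2
      exact Prod.ext h1 h2
    | some e =>
      rw [h] at h1 h2
      exact Prod.ext h1 h2
  choose Z hZ using hval
  have : Nonempty (∀ q, Option (act q)) := ⟨fun _ => none⟩
  obtain ⟨π, hπ⟩ := exists_eventually_min (fun π n => ∑ q, pot α β n (Z π q)) (by
    intro π π'
    simp only [pot_sum]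
    have := eventually_pow_mul_trichotomy hα hβ (∑ q, Z π q - ∑ q, Z π' q).1
      (∑ q, Z π q - ∑ q, Z π' q).2
    have key : ∀ n, pot α β n (∑ q, Z π q) - pot α β n (∑ q, Z π' q) =
      α ^ n * (∑ q, Z π q - ∑ q, Z π' q).1 - β ^ n * (∑ q, Z π q - ∑ q, Z π' q).2 := by
      intro n; rw [← pot_sub]; rfl
    rcases this with h | h | h
    · exact Or.inr (h.mono fun n hn => by linarith [key n])
    · exact Or.inr (h.mono fun n hn => by linarith [key n])
    · exact Or.inl (h.mono fun n hn => by linarith [key n]))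
  -- Switching to a better action at one state improves the strategy.
  have main (q₀ : V) (o : Option (act q₀)) : ∀ᶠ n in atTop,
      pot α β n (Z π q₀) ≤
        pot α β n (o.elim 0 fun e => pullback α β e.1.2 (Z π e.1.1)) := by
    set T := o.elim 0 fun e => pullback α β e.1.2 (Z π e.1.1) with hT
    -- `T` holds the coefficients of the cost of the alternative action.
    rcases eventually_pow_mul_trichotomy hα hβ (T - Z π q₀).1 (T - Z π q₀).2 with h | h | h
    · exact h.mono fun n hn => by
        have := pot_sub α β n T (Z π q₀); unfold pot at this ⊢; linarith
    · exact h.mono fun n hn => by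
        have := pot_sub α β n T (Z π q₀); unfold pot at this ⊢; linarith
    exfalso
    let π' := Function.update π q₀ o
    obtain ⟨N, hN⟩ := eventually_atTop.1 h
    have hneg : ∀ n ≥ N, pot α β n T < pot α β n (Z π q₀) := fun n hn => by
      have h1 := hN n hn
      have h2 := pot_sub α β n T (Z π q₀)
      have h3 : pot α β n (T - Z π q₀) < 0 := by unfold pot; linarith
      linarith
    -- `D n q` is the change of the cost from `q` at time `n` that the switch causes.
    let D : ℕ → V → ℚ := fun n q => pot α β n (Z π' q - Z π q)
    have hZ' : ∀ q, q ≠ q₀ → Z π' q = (π q).elim 0 fun e => pullback α β e.1.2 (Z π' e.1.1) := by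
      intro q hq
      rw [hZ π' q]; simp [π', hq]
    have hZ₀ : Z π' q₀ = o.elim 0 fun e => pullback α β e.1.2 (Z π' e.1.1) := by
      rw [hZ π' q₀]; simp [π']
    -- A bound for all changes at time `n`, which tends to zero.
    let M : ℕ → ℚ := fun n => ∑ q, |D n q|
    have hDM : ∀ n q, D n q ≤ M n := fun n q =>
      (le_abs_self _).trans (Finset.single_le_sum (f := fun q => |D n q|)
        (fun q _ => abs_nonneg _) (Finset.mem_univ q))
    have hM0 : ∀ n, 0 ≤ M n := fun n => Finset.sum_nonneg fun q _ => abs_nonneg _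
    -- Elsewhere than at `q₀` the change is that of the successor; at `q₀`, `hneg` makes it smaller.
    have hstep₀ : ∀ n ≥ N, ∀ B : ℚ, 0 ≤ B → (∀ q, D (n + 1) q ≤ B) → D n q₀ < B := by
      intro n hn B hB hB'
      have h1 := hneg n hn
      simp only [D, pot_sub] at hB' ⊢
      rw [hZ₀]
      cases o with
      | none =>
        simp only [hT, Option.elim_none] at h1 ⊢
        linarith
      | some e =>
        simp only [hT, Option.elim_some, pot_pullback] at h1 ⊢
        linarith [hB' e.1.1]
    have hstep : ∀ n ≥ N, ∀ B : ℚ, 0 ≤ B → (∀ q, D (n + 1) q ≤ B) → ∀ q, D n q ≤ B := by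
      intro n hn B hB hB' q
      by_cases hq : q = q₀
      · exact hq ▸ (hstep₀ n hn B hB hB').le
      simp only [D, pot_sub] at hB' ⊢
      rw [hZ' q hq, hZ π q]
      cases π q with
      | none => simpa using hB
      | some e =>
        simp only [Option.elim_some, pot_pullback]
        linarith [hB' e.1.1]
    have hiter : ∀ k, ∀ n ≥ N, ∀ q, D n q ≤ M (n + k) := by
      intro k
      induction k with
      | zero => exact fun n _ q => hDM n q
      | succ k ih =>
        intro n hn q
        refine hstep n hn _ (hM0 _) (fun p => ?_) q
        have := ih (n + 1) (by omega) p
        rwa [show n + 1 + k = n + (k + 1) by ring] at this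
    have hMlim : Tendsto M atTop (𝓝 0) := by
      have : Tendsto M atTop (𝓝 (∑ _q : V, |(0 : ℚ)|)) :=
        tendsto_finsetSum _ fun q _ => (tendsto_pot hα hα' hβ hβ' _).abs
      simpa using this
    have hD : ∀ n ≥ N, ∀ q, D n q ≤ 0 := fun n hn q =>
      ge_of_tendsto' (hMlim.comp (tendsto_add_atTop_nat n)) fun k => by
        simpa [add_comm] using hiter k n hn q
    -- No change is positive and the one at `q₀` is negative, against the minimality of `π`.
    obtain ⟨n, hn, hnN⟩ := ((hπ π').and (eventually_ge_atTop N)).exists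
    have hlt : ∑ q, D n q < ∑ _q : V, (0 : ℚ) :=
      Finset.sum_lt_sum (fun q _ => hD n hnN q) ⟨q₀, Finset.mem_univ _,
        hstep₀ n hnN 0 le_rfl fun q => hD (n + 1) (by omega) q⟩
    simp only [D, pot_sub, Finset.sum_sub_distrib, Finset.sum_const_zero] at hlt
    linarith
  refine ⟨Z π, fun q => ?_, fun q e he => main q (some ⟨e, he⟩), fun q => ?_⟩
  · have := main q none
    simpa [pot] using this
  · have := hZ π q
    cases h : π q with
    | none => exact Or.inl (by simpa [h] using this)
    | some e => exact Or.inr ⟨e.1, e.2, by simpa [h] using this⟩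

end

/-! ### Certificates for the infimum of the costs of walks -/

section

open Filter Topology

/-- A weighted graph with two discount factors `α` and `β`, which are meant to be less than one. A
step taken at time `n` along an edge `(p, q, a, d)` costs `a * α ^ n - d * β ^ n`. -/
structure CostGraph (S : Type*) where
  α : ℚ
  β : ℚ
  init : Set S
  edge : Set (S × S × ℚ × ℚ)

namespace CostGraph

variable {S : Type*}

/-- `G.Walk n q x`: some walk of `n` steps from an initial state to `q` has total cost `x`. -/
inductive Walk (G : CostGraph S) : ℕ → S → ℚ → Prop
  | start {q} (h : q ∈ G.init) : Walk G 0 q 0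
  | step {n p q x w} (h : Walk G n p x) (he : (p, q, w) ∈ G.edge) :
      Walk G (n + 1) q (x + pot G.α G.β n w)

/-- The exponential sum with coefficients `c` is nonnegative from time `N` on. -/
def NonnegFrom (G : CostGraph S) (N : ℕ) (c : ℚ × ℚ) : Prop := ∀ n ≥ N, 0 ≤ pot G.α G.β n c

/-- The exponential sum with coefficients `c` is positive from time `N` on. -/
def PosFrom (G : CostGraph S) (N : ℕ) (c : ℚ × ℚ) : Prop := ∀ n ≥ N, 0 < pot G.α G.β n c

/-- The coefficients of the loss, relative to potentials `c` at the source and `c'` at the target,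
of a step with weights `w`. -/
def slack (G : CostGraph S) (c w c' : ℚ × ℚ) : ℚ × ℚ := pullback G.α G.β w c' - c

theorem pot_slack (G : CostGraph S) (n : ℕ) (c w c' : ℚ × ℚ) :
    pot G.α G.β n (G.slack c w c') =
      pot G.α G.β n w + pot G.α G.β (n + 1) c' - pot G.α G.β n c := by
  rw [slack, pot_sub, pot_pullback]

/-- A finite certificate that `v` is the infimum of the costs of nonempty walks, and that it is
attained if and only if `att` is `true`. The set `C` consists of states with the coefficients of a
potential and a flag. From time `N` on, a potential bounds from below the cost of every walk from
its state, stopping included; the flag says that the bound is strict for every walk, though it is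
approached.

The fields `halt` and `edge` make the potentials and the flags sound, `tight` provides optimal steps
between flagged states. The fields `short` and `long` compare `v` with the walks up to length `N`,
and the last two fields make `v` the greatest lower bound. -/
structure IsCertificate (G : CostGraph S) (v : ℚ) (att : Bool) (N : ℕ)
    (C : Set (S × (ℚ × ℚ) × Bool)) : Prop where
  one_le : 1 ≤ N
  covers : ∀ q ∈ G.init, ∃ c ∈ C, c.1 = q
  halt : ∀ c ∈ C, G.NonnegFrom N (-c.2.1) ∧ (c.2.2 = true → G.PosFrom N (-c.2.1))
  edge : ∀ c ∈ C, ∀ e ∈ G.edge, e.1 = c.1 → ∃ c' ∈ C, c'.1 = e.2.1 ∧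
    G.NonnegFrom N (G.slack c.2.1 e.2.2 c'.2.1) ∧
    (c.2.2 = true → c'.2.2 = true ∨ G.PosFrom N (G.slack c.2.1 e.2.2 c'.2.1))
  tight : ∀ c ∈ C, c.2.2 = true → ∃ e ∈ G.edge, e.1 = c.1 ∧ ∃ c' ∈ C, c'.1 = e.2.1 ∧
    c'.2.2 = true ∧ G.NonnegFrom N (-G.slack c.2.1 e.2.2 c'.2.1)
  short : ∀ k < N, 1 ≤ k → ∀ q x, G.Walk k q x → v ≤ x ∧ (att = false → v < x)
  long : ∀ q x, G.Walk N q x → ∃ c ∈ C, c.1 = q ∧ v ≤ x + pot G.α G.β N c.2.1 ∧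
    (att = false → c.2.2 = true ∨ v < x + pot G.α G.β N c.2.1)
  attained : att = true → ∃ k ≥ 1, ∃ q x, G.Walk k q x ∧ x ≤ v
  approached : att = false → ∃ q x, G.Walk N q x ∧ ∃ c ∈ C, c.1 = q ∧ c.2.2 = true ∧
    x + pot G.α G.β N c.2.1 ≤ v

theorem pot_neg (α β : ℚ) (n : ℕ) (c : ℚ × ℚ) : pot α β n (-c) = -pot α β n c := by
  simp only [pot, Prod.fst_neg, Prod.snd_neg]; ring

namespace IsCertificate

variable {G : CostGraph S} {v : ℚ} {att : Bool} {N : ℕ} {C : Set (S × (ℚ × ℚ) × Bool)}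

theorem exists_mem_of_walk (h : G.IsCertificate v att N C) {k : ℕ} {q : S} {x : ℚ}
    (hw : G.Walk k q x) : ∃ c ∈ C, c.1 = q := by
  induction hw with
  | start hq => exact h.covers _ hq
  | step _ he ih =>
    obtain ⟨c, hc, rfl⟩ := ih
    obtain ⟨c', hc', h1, -⟩ := h.edge c hc _ he rfl
    exact ⟨c', hc', h1⟩

/-- From time `N` on, the cost so far plus the potential of the current state is at least `v`; in
the non-attained case it is greater than `v` unless the state is flagged. -/
theorem exists_lower_bound (h : G.IsCertificate v att N C) {k : ℕ} {q : S} {x : ℚ}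
    (hw : G.Walk k q x) (hk : N ≤ k) : ∃ c ∈ C, c.1 = q ∧ v ≤ x + pot G.α G.β k c.2.1 ∧
      (att = false → c.2.2 = true ∨ v < x + pot G.α G.β k c.2.1) := by
  induction hw with
  | start hq =>
    obtain rfl : N = 0 := by omega
    exact h.long _ _ (.start hq)
  | @step n p q x w hw he ih =>
    rcases hk.eq_or_lt with rfl | hk
    · exact h.long _ _ (.step hw he)
    have hn : N ≤ n := by omega
    obtain ⟨c, hc, rfl, h1, h2⟩ := ih hn
    obtain ⟨c', hc', h3, h4, h5⟩ := h.edge c hc _ he rfl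
    have h6 := h4 n hn
    rw [pot_slack] at h6
    refine ⟨c', hc', h3, by linarith, fun ha => ?_⟩
    rcases h2 ha with h2 | h2
    · rcases h5 h2 with h5 | h5
      · exact Or.inl h5
      · have h7 := h5 n hn
        rw [pot_slack] at h7
        exact Or.inr (by linarith)
    · exact Or.inr (by linarith)

theorem le_of_walk (h : G.IsCertificate v att N C) {k : ℕ} {q : S} {x : ℚ}
    (hk : 1 ≤ k) (hw : G.Walk k q x) : v ≤ x ∧ (att = false → v < x) := by
  rcases lt_or_ge k N with hkN | hkN
  · exact h.short k hkN hk q x hw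
  obtain ⟨c, hc, rfl, h1, h2⟩ := h.exists_lower_bound hw hkN
  obtain ⟨h3, h4⟩ := h.halt c hc
  have h5 := h3 k hkN
  rw [pot_neg] at h5
  refine ⟨by linarith, fun ha => ?_⟩
  rcases h2 ha with h2 | h2
  · have h6 := h4 h2 k hkN
    rw [pot_neg] at h6
    linarith
  · linarith

/-- Following optimal edges, the potentials tend to zero, so the costs of the prefixes come
arbitrarily close to the certified value. -/
theorem exists_walk_lt (h : G.IsCertificate v att N C) (hC : C.Finite)
    (hα : 0 < G.α) (hα' : G.α < 1) (hβ : 0 < G.β) (hβ' : G.β < 1) {ε : ℚ} (hε : 0 < ε) :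
    ∃ k ≥ 1, ∃ q x, G.Walk k q x ∧ x < v + ε := by
  cases hatt : att with
  | true =>
    obtain ⟨k, hk, q, x, hw, hx⟩ := h.attained hatt
    exact ⟨k, hk, q, x, hw, by linarith⟩
  | false =>
    have key : ∀ j, ∃ q x, G.Walk (N + j) q x ∧ ∃ c ∈ C, c.1 = q ∧ c.2.2 = true ∧
        x + pot G.α G.β (N + j) c.2.1 ≤ v := by
      intro j
      induction j with
      | zero => exact h.approached hatt
      | succ j ih =>
        obtain ⟨q, x, hw, c, hc, rfl, hflag, hx⟩ := ih
        obtain ⟨e, he, h1, c', hc', h2, hflag', h3⟩ := h.tight c hc hflag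
        have h4 := h3 (N + j) (by omega)
        rw [pot_neg, pot_slack] at h4
        refine ⟨e.2.1, x + pot G.α G.β (N + j) e.2.2, .step hw (h1 ▸ he), c', hc', h2, hflag', ?_⟩
        rw [← add_assoc]
        linarith
    have hsmall : ∀ᶠ n in atTop, ∀ c ∈ C, -ε < pot G.α G.β n c.2.1 :=
      (eventually_all_finite hC).2 fun c _ =>
        (tendsto_pot hα hα' hβ hβ' c.2.1).eventually (lt_mem_nhds (by linarith))
    obtain ⟨n, hn⟩ := eventually_atTop.1 hsmall
    obtain ⟨q, x, hw, c, hc, -, -, hx⟩ := key n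
    refine ⟨N + n, by have := h.one_le; omega, q, x, hw, ?_⟩
    have := hn (N + n) (by omega) c hc
    linarith

end IsCertificate

theorem finite_reachable {G : CostGraph S} (hI : G.init.Finite) (hE : G.edge.Finite) :
    {q | ∃ k x, G.Walk k q x}.Finite := by
  refine (hI.union (hE.image fun e => e.2.1)).subset ?_
  rintro q ⟨k, x, hw⟩
  cases hw with
  | start h => exact Or.inl h
  | step _ he => exact Or.inr ⟨_, he, rfl⟩

theorem finite_walk {G : CostGraph S} (hI : G.init.Finite) (hE : G.edge.Finite) (k : ℕ) :
    {p : S × ℚ | G.Walk k p.1 p.2}.Finite := by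
  induction k with
  | zero =>
    refine (hI.image fun q => (q, (0 : ℚ))).subset ?_
    rintro ⟨q, x⟩ hw
    cases hw with
    | start h => exact ⟨q, h, rfl⟩
  | succ k ih =>
    refine ((ih.prod hE).image fun t => (t.2.2.1, t.1.2 + pot G.α G.β k t.2.2.2)).subset ?_
    rintro ⟨q, x⟩ hw
    cases hw with
    | step h he => exact ⟨((_, _), (_, _, _)), ⟨h, he⟩, rfl⟩

/-- Certificates exist, over the reachable states only. The flag of a state says that no path of
steps without loss leads from it to a state whose potential vanishes. -/
theorem exists_isCertificate {G : CostGraph S} (hI : G.init.Finite) (hE : G.edge.Finite)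
    (hα : 0 < G.α) (hα' : G.α < 1) (hβ : 0 < G.β) (hβ' : G.β < 1)
    (hne : ∃ q x, G.Walk 1 q x) :
    ∃ v att N C, C.Finite ∧ (∀ c ∈ C, ∃ k x, G.Walk k c.1 x) ∧ G.IsCertificate v att N C := by
  classical
  let V := {q | ∃ k x, G.Walk k q x}
  have : Finite V := (finite_reachable hI hE).to_subtype
  let act : V → Set (V × ℚ × ℚ) := fun q => {e | (q.1, e.1.1, e.2) ∈ G.edge}
  have hact : ∀ q, (act q).Finite := fun q => by
    refine (hE.preimage (f := fun e : V × ℚ × ℚ => (q.1, e.1.1, e.2)) ?_)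
    rintro ⟨a, b⟩ - ⟨c, d⟩ - h
    simp only [Prod.mk.injEq] at h
    exact Prod.ext (Subtype.ext h.2.1) h.2.2
  obtain ⟨Z, hZ0, hZe, hZt⟩ := exists_potential hα hα' hβ hβ' act hact
  let sl : V → V × ℚ × ℚ → ℚ × ℚ := fun q e => G.slack (Z q) e.2 (Z e.1)
  -- From time `N` on, no relevant exponential sum changes its sign.
  have hev : ∀ᶠ n in atTop, 2 ≤ n ∧
      (∀ q, G.NonnegFrom n (-Z q) ∧ (G.PosFrom n (-Z q) ∨ ∀ m ≥ n, pot G.α G.β m (Z q) = 0)) ∧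
      ∀ q, ∀ e ∈ act q, G.NonnegFrom n (sl q e) ∧
        (G.PosFrom n (sl q e) ∨ ∀ m ≥ n, pot G.α G.β m (sl q e) = 0) := by
    have dich : ∀ c : ℚ × ℚ, (∀ᶠ n in atTop, 0 ≤ pot G.α G.β n c) → ∀ᶠ n in atTop,
        G.NonnegFrom n c ∧ (G.PosFrom n c ∨ ∀ m ≥ n, pot G.α G.β m c = 0) := by
      intro c hc
      have h1 : ∀ᶠ n in atTop, G.NonnegFrom n c := eventually_forall_ge_atTop.2 hc
      rcases eventually_pow_mul_trichotomy hα hβ c.1 c.2 with h | h | h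
      · have : ∀ᶠ n in atTop, G.PosFrom n c :=
          eventually_forall_ge_atTop.2 (h.mono fun n hn => sub_pos.2 hn)
        filter_upwards [h1, this] with n hn hn' using ⟨hn, Or.inl hn'⟩
      · have : ∀ᶠ n in atTop, ∀ m ≥ n, pot G.α G.β m c = 0 :=
          eventually_forall_ge_atTop.2 (h.mono fun n hn => sub_eq_zero.2 hn.symm)
        filter_upwards [h1, this] with n hn hn' using ⟨hn, Or.inr hn'⟩
      · obtain ⟨n, hn, hn'⟩ := (h.and hc).exists
        exact absurd hn (not_lt.2 (sub_nonneg.1 hn'))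
    refine (eventually_ge_atTop 2).and ((eventually_all.2 fun q => ?_).and
      (eventually_all.2 fun q => (eventually_all_finite (hact q)).2 fun e he => ?_))
    · have := dich (-Z q) ((hZ0 q).mono fun n hn => by rw [pot_neg]; linarith)
      simpa only [pot_neg, neg_eq_zero] using this
    · exact dich _ ((hZe q e he).mono fun n hn => by
        simp only [sl, slack, pot_sub]; linarith)
  obtain ⟨N, hN2, hNZ, hNe⟩ := hev.exists
  -- Steps without loss, states where stopping is without loss, and states from which the potential
  -- is attained by finitely many steps without loss.
  let tight : V → V → Prop := fun q q' => ∃ w, (q', w) ∈ act q ∧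
    ∀ m ≥ N, pot G.α G.β m (sl q (q', w)) = 0
  let zero : V → Prop := fun q => ∀ m ≥ N, pot G.α G.β m (Z q) = 0
  let att : V → Prop := fun q => ∃ q', Relation.ReflTransGen tight q q' ∧ zero q'
  -- From an attainable state, the potential is the cost of an actual continuation.
  have hatt : ∀ q, att q → ∀ n ≥ N, ∀ x, G.Walk n q.1 x →
      ∃ m ≥ N, ∃ q', G.Walk m q' (x + pot G.α G.β n (Z q)) := by
    rintro q ⟨q', hr, hz⟩
    induction hr using Relation.ReflTransGen.head_induction_on with
    | refl => exact fun n hn x hw => ⟨n, hn, q', by rwa [hz n hn, add_zero]⟩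
    | head hab _ ih =>
      intro n hn x hw
      obtain ⟨w, hw1, hw2⟩ := hab
      obtain ⟨m, hm, p, hp⟩ := ih (n + 1) (by omega) _ (hw.step hw1)
      refine ⟨m, hm, p, ?_⟩
      have := hw2 n hn
      simp only [sl, pot_slack] at this
      convert hp using 1
      linarith
  -- The candidates for the infimum.
  let cand : Set ℚ := {x | ∃ k, 1 ≤ k ∧ k < N ∧ ∃ q, G.Walk k q x} ∪
    {y | ∃ (q : V) (x : ℚ), G.Walk N q.1 x ∧ y = x + pot G.α G.β N (Z q)}
  have hcf : cand.Finite := by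
    refine Set.Finite.union ?_ ?_
    · refine ((Set.finite_lt_nat N).biUnion fun k _ =>
        (finite_walk hI hE k).image Prod.snd).subset ?_
      rintro x ⟨k, -, hk, q, hw⟩
      exact Set.mem_biUnion hk ⟨(q, x), hw, rfl⟩
    · refine (((Set.finite_univ (α := V)).prod ((finite_walk hI hE N).image Prod.snd)).image
        fun t => t.2 + pot G.α G.β N (Z t.1)).subset ?_
      rintro y ⟨q, x, hw, rfl⟩
      exact ⟨(q, x), ⟨trivial, (q.1, x), hw, rfl⟩, rfl⟩
  have hcn : cand.Nonempty := by
    obtain ⟨q, x, hw⟩ := hne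
    exact ⟨x, Or.inl ⟨1, le_rfl, by omega, q, hw⟩⟩
  obtain ⟨v, hv, hmin⟩ := Set.exists_min_image cand id hcf hcn
  simp only [id] at hmin
  let isAtt : Prop := ∃ k ≥ 1, ∃ q, G.Walk k q v
  refine ⟨v, decide isAtt, N, Set.range fun q : V => (q.1, Z q, decide ¬ att q),
    Set.finite_range _, ?_, ?_⟩
  · rintro _ ⟨q, rfl⟩
    exact q.2
  refine ⟨by omega, fun q hq => ⟨_, ⟨⟨q, 0, 0, .start hq⟩, rfl⟩, rfl⟩, ?_, ?_, ?_, ?_, ?_, ?_, ?_⟩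
  · rintro _ ⟨q, rfl⟩
    refine ⟨(hNZ q).1, fun hf => ?_⟩
    simp only [decide_eq_true_eq] at hf
    exact (hNZ q).2.resolve_right fun hz => hf ⟨q, .refl, hz⟩
  · rintro _ ⟨q, rfl⟩ ⟨p, p', w⟩ he rfl
    obtain ⟨k, x, hw⟩ := q.2
    let q' : V := ⟨p', _, _, hw.step he⟩
    have he' : (q', w) ∈ act q := he
    refine ⟨_, ⟨q', rfl⟩, rfl, (hNe q _ he').1, fun hf => ?_⟩
    simp only [decide_eq_true_eq] at hf ⊢
    by_contra! hcon
    obtain ⟨⟨r, hr, hz⟩, hnp⟩ := hcon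
    have ht := (hNe q _ he').2.resolve_left hnp
    exact hf ⟨r, .head ⟨w, he', ht⟩ hr, hz⟩
  · rintro _ ⟨q, rfl⟩ hf
    simp only [decide_eq_true_eq] at hf
    rcases hZt q with hz | ⟨⟨q', w⟩, he, hz⟩
    · exact absurd ⟨q, .refl, fun m _ => by simp [hz, pot]⟩ hf
    -- The optimal action is without loss, so its target is flagged as well.
    · have hs : ∀ m, pot G.α G.β m (sl q (q', w)) = 0 := fun m => by
        simp only [sl, slack, ← hz, sub_self]
        simp [pot]
      refine ⟨_, he, rfl, _, ⟨q', rfl⟩, rfl, ?_, fun m _ => ?_⟩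
      · simp only [decide_eq_true_eq]
        rintro ⟨r, hr, hzr⟩
        exact hf ⟨r, .head ⟨w, he, fun m _ => hs m⟩ hr, hzr⟩
      · have := hs m
        simp only [sl] at this
        simp [pot_neg, this]
  · intro k hk hk1 q x hw
    have hle := hmin x (Or.inl ⟨k, hk1, hk, q, hw⟩)
    refine ⟨hle, fun ha => lt_of_le_of_ne hle ?_⟩
    rintro rfl
    exact (decide_eq_false_iff_not.1 ha) ⟨k, hk1, q, hw⟩
  · intro q x hw
    let q' : V := ⟨q, _, _, hw⟩
    have hle := hmin _ (Or.inr ⟨q', x, hw, rfl⟩)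
    refine ⟨_, ⟨q', rfl⟩, rfl, hle, fun ha => ?_⟩
    simp only [decide_eq_true_eq]
    by_contra! hcon
    obtain ⟨m, hm, p, hp⟩ := hatt q' hcon.1 N le_rfl x hw
    rw [le_antisymm hcon.2 hle] at hp
    exact (decide_eq_false_iff_not.1 ha) ⟨m, by omega, p, hp⟩
  · intro ha
    obtain ⟨k, hk, q, hw⟩ := of_decide_eq_true ha
    exact ⟨k, hk, q, v, hw, le_rfl⟩
  · intro ha
    have hna : ¬ isAtt := decide_eq_false_iff_not.1 ha
    rcases hv with ⟨k, hk, -, q, hw⟩ | ⟨q, x, hw, hx⟩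
    · exact absurd ⟨k, hk, q, hw⟩ hna
    · refine ⟨q, x, hw, _, ⟨q, rfl⟩, rfl, ?_, hx.ge⟩
      simp only [decide_eq_true_eq]
      intro hcon
      obtain ⟨m, hm, p, hp⟩ := hatt q hcon N le_rfl x hw
      rw [← hx] at hp
      exact hna ⟨m, by omega, p, hp⟩

end CostGraph

end

/-! ### Computability by search -/

theorem PrimrecPred.ball {α β : Type*} [Primcodable α] [Primcodable β] {f : α → List β}
    {p : α → β → Prop} (hf : Primrec f) (hp : PrimrecPred fun x : α × β => p x.1 x.2) :
    PrimrecPred fun a => ∀ b ∈ f a, p a b :=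
  (PrimrecRel.forall_mem_list (R := fun b a => p a b)
    (hp.comp (f := fun x : β × α => (x.2, x.1)) (Primrec.snd.pair Primrec.fst))).comp hf Primrec.id

theorem PrimrecPred.bex {α β : Type*} [Primcodable α] [Primcodable β] {f : α → List β}
    {p : α → β → Prop} (hf : Primrec f) (hp : PrimrecPred fun x : α × β => p x.1 x.2) :
    PrimrecPred fun a => ∃ b ∈ f a, p a b :=
  (PrimrecRel.exists_mem_list (R := fun b a => p a b)
    (hp.comp (f := fun x : β × α => (x.2, x.1)) (Primrec.snd.pair Primrec.fst))).comp hf Primrec.id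

theorem PrimrecPred.ball_lt {α : Type*} [Primcodable α] {f : α → ℕ}
    {p : α → ℕ → Prop} (hf : Primrec f) (hp : PrimrecPred fun x : α × ℕ => p x.1 x.2) :
    PrimrecPred fun a => ∀ k < f a, p a k :=
  (PrimrecPred.ball (Primrec.list_range.comp hf) hp).of_eq fun _ => by simp only [List.mem_range]

theorem PrimrecPred.imp {α : Type*} [Primcodable α] {p q : α → Prop} (hp : PrimrecPred p)
    (hq : PrimrecPred q) : PrimrecPred fun a => p a → q a :=
  (hp.not.or hq).of_eq fun _ => imp_iff_not_or.symm

theorem PrimrecPred.eq_of {α β : Type*} [Primcodable α] [Primcodable β] {f g : α → β}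
    (hf : Primrec f) (hg : Primrec g) : PrimrecPred fun a => f a = g a :=
  Primrec.eq.comp hf hg

/-- Unbounded search: if every input has some `b` that passes a primitive recursive test, then one
such `b` can be computed. -/
theorem exists_computable_of_certificate {α β : Type*} [Primcodable α] [Primcodable β]
    {p : α × β → Prop} (hp : PrimrecPred p) (htot : ∀ a, ∃ b, p (a, b)) :
    ∃ f : α → β, Computable f ∧ ∀ a, p (a, f a) := by
  obtain ⟨_, hp⟩ := hp
  let F : α → ℕ → Option β := fun a n =>
    (Encodable.decode n : Option β).bind fun b => if p (a, b) then some b else none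
  have hF : Computable₂ F := by
    refine Primrec.to_comp (Primrec.option_bind (Primrec.decode.comp Primrec.snd) ?_)
    refine Primrec.ite (Primrec.primrecPred (hp.comp ?_)) (Primrec.option_some.comp Primrec.snd)
      (Primrec.const none)
    exact (Primrec.fst.comp Primrec.fst).pair Primrec.snd
  have hmem : ∀ {a b n}, b ∈ F a n → p (a, b) := by
    intro a b n h
    obtain ⟨c, -, hc⟩ := Option.bind_eq_some_iff.1 h
    split_ifs at hc with hpc
    exact Option.some_inj.1 hc ▸ hpc
  have hdom : ∀ a, (Nat.rfindOpt (F a)).Dom := by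
    intro a
    obtain ⟨b, hb⟩ := htot a
    exact Nat.rfindOpt_dom.2 ⟨Encodable.encode b, b, by simp [F, hb]⟩
  refine ⟨fun a => (Nat.rfindOpt (F a)).get (hdom a),
    (Partrec.rfindOpt hF).of_eq fun a => (Part.some_get _).symm, fun a => ?_⟩
  obtain ⟨n, hn⟩ := Nat.rfindOpt_spec (Part.get_mem (hdom a))
  exact hmem hn

/-! ### Rational arithmetic on triples of natural numbers -/

/-- A rational number as a triple of natural numbers: `(p, m, d)` stands for `(p - m) / (d + 1)`.
The arithmetic operations and the order are polynomial in the components. -/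
abbrev Fr : Type := ℕ × ℕ × ℕ

namespace Fr

/-- The rational number that a triple stands for. -/
def val (x : Fr) : ℚ := ((x.1 : ℚ) - x.2.1) / (x.2.2 + 1)

def add (x y : Fr) : Fr :=
  (x.1 * (y.2.2 + 1) + y.1 * (x.2.2 + 1), x.2.1 * (y.2.2 + 1) + y.2.1 * (x.2.2 + 1),
    x.2.2 * y.2.2 + x.2.2 + y.2.2)

def mul (x y : Fr) : Fr :=
  (x.1 * y.1 + x.2.1 * y.2.1, x.1 * y.2.1 + x.2.1 * y.1, x.2.2 * y.2.2 + x.2.2 + y.2.2)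

def neg (x : Fr) : Fr := (x.2.1, x.1, x.2.2)

def le (x y : Fr) : Prop :=
  x.1 * (y.2.2 + 1) + y.2.1 * (x.2.2 + 1) ≤ y.1 * (x.2.2 + 1) + x.2.1 * (y.2.2 + 1)

/-- The triple of a fraction that is given by numerator and nonzero denominator. -/
def ofFrac (z : ℤ × ℕ) : Fr := (z.1.toNat, (-z.1).toNat, z.2 - 1)

theorem val_add (x y : Fr) : (add x y).val = x.val + y.val := by
  have hx : (x.2.2 : ℚ) + 1 ≠ 0 := by positivity
  have hy : (y.2.2 : ℚ) + 1 ≠ 0 := by positivity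
  have h : (x.2.2 : ℚ) * y.2.2 + x.2.2 + y.2.2 + 1 = (x.2.2 + 1) * (y.2.2 + 1) := by ring
  simp only [val, add]; push_cast; rw [h]; field_simp; ring

theorem val_mul (x y : Fr) : (mul x y).val = x.val * y.val := by
  have hx : (x.2.2 : ℚ) + 1 ≠ 0 := by positivity
  have hy : (y.2.2 : ℚ) + 1 ≠ 0 := by positivity
  have h : (x.2.2 : ℚ) * y.2.2 + x.2.2 + y.2.2 + 1 = (x.2.2 + 1) * (y.2.2 + 1) := by ring
  simp only [val, mul]; push_cast; rw [h]; field_simp; ring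

theorem val_neg (x : Fr) : (neg x).val = -x.val := by
  simp only [val, neg]; ring

theorem val_zero : val (0, 0, 0) = 0 := by simp [val]

theorem val_one : val (1, 0, 0) = 1 := by simp [val]

theorem le_iff (x y : Fr) : le x y ↔ x.val ≤ y.val := by
  have hx : (0 : ℚ) < (x.2.2 : ℚ) + 1 := by positivity
  have hy : (0 : ℚ) < (y.2.2 : ℚ) + 1 := by positivity
  rw [val, val, div_le_div_iff₀ hx hy, le, ← Nat.cast_le (α := ℚ)]
  push_cast
  constructor <;> intro h <;> linarith

theorem val_ofFrac {z : ℤ × ℕ} (hz : z.2 ≠ 0) : (ofFrac z).val = z.1 / z.2 := by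
  obtain ⟨a, b⟩ := z
  obtain ⟨b, rfl⟩ := Nat.exists_eq_succ_of_ne_zero hz
  have h : ((a.toNat : ℤ) : ℚ) - (((-a).toNat : ℤ) : ℚ) = a := by
    rw [← Int.cast_sub, Int.toNat_sub_toNat_neg]
  simp only [Int.cast_natCast] at h
  simp only [val, ofFrac, h]
  simp

theorem exists_val_eq (q : ℚ) : ∃ x : Fr, x.val = q :=
  ⟨ofFrac (q.num, q.den), by rw [val_ofFrac q.den_nz, Rat.num_div_den]⟩

section Primrec

open Primrec

theorem primrec_add : Primrec₂ add := by
  have x1 : Primrec fun p : Fr × Fr => p.1.1 := fst.comp fst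
  have x2 : Primrec fun p : Fr × Fr => p.1.2.1 := fst.comp (snd.comp fst)
  have x3 : Primrec fun p : Fr × Fr => p.1.2.2 := snd.comp (snd.comp fst)
  have y1 : Primrec fun p : Fr × Fr => p.2.1 := fst.comp snd
  have y2 : Primrec fun p : Fr × Fr => p.2.2.1 := fst.comp (snd.comp snd)
  have y3 : Primrec fun p : Fr × Fr => p.2.2.2 := snd.comp (snd.comp snd)
  exact (nat_add.comp (nat_mul.comp x1 (succ.comp y3)) (nat_mul.comp y1 (succ.comp x3))).pair
    ((nat_add.comp (nat_mul.comp x2 (succ.comp y3)) (nat_mul.comp y2 (succ.comp x3))).pair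
      (nat_add.comp (nat_add.comp (nat_mul.comp x3 y3) x3) y3))

theorem primrec_mul : Primrec₂ mul := by
  have x1 : Primrec fun p : Fr × Fr => p.1.1 := fst.comp fst
  have x2 : Primrec fun p : Fr × Fr => p.1.2.1 := fst.comp (snd.comp fst)
  have x3 : Primrec fun p : Fr × Fr => p.1.2.2 := snd.comp (snd.comp fst)
  have y1 : Primrec fun p : Fr × Fr => p.2.1 := fst.comp snd
  have y2 : Primrec fun p : Fr × Fr => p.2.2.1 := fst.comp (snd.comp snd)
  have y3 : Primrec fun p : Fr × Fr => p.2.2.2 := snd.comp (snd.comp snd)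
  exact (nat_add.comp (nat_mul.comp x1 y1) (nat_mul.comp x2 y2)).pair
    ((nat_add.comp (nat_mul.comp x1 y2) (nat_mul.comp x2 y1)).pair
      (nat_add.comp (nat_add.comp (nat_mul.comp x3 y3) x3) y3))

theorem primrec_neg : Primrec neg :=
  (fst.comp snd).pair (fst.pair (snd.comp snd))

theorem primrec_le : PrimrecRel le := by
  have x1 : Primrec fun p : Fr × Fr => p.1.1 := fst.comp fst
  have x2 : Primrec fun p : Fr × Fr => p.1.2.1 := fst.comp (snd.comp fst)
  have x3 : Primrec fun p : Fr × Fr => p.1.2.2 := snd.comp (snd.comp fst)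
  have y1 : Primrec fun p : Fr × Fr => p.2.1 := fst.comp snd
  have y2 : Primrec fun p : Fr × Fr => p.2.2.1 := fst.comp (snd.comp snd)
  have y3 : Primrec fun p : Fr × Fr => p.2.2.2 := snd.comp (snd.comp snd)
  exact nat_le.comp
    (nat_add.comp (nat_mul.comp x1 (succ.comp y3)) (nat_mul.comp y2 (succ.comp x3)))
    (nat_add.comp (nat_mul.comp y1 (succ.comp x3)) (nat_mul.comp x2 (succ.comp y3)))

theorem primrec_toNat : Primrec Int.toNat := by
  -- The code of a natural number `n` is `2 * n`, that of `-(n + 1)` is `2 * n + 1`.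
  have : Primrec fun z : ℤ => cond (Encodable.encode z).bodd 0 (Encodable.encode z).div2 :=
    .cond (nat_bodd.comp .encode) (.const 0) (nat_div2.comp .encode)
  refine this.of_eq fun z => ?_
  have h1 : ∀ n : ℕ, Encodable.encode (Int.ofNat n) = 2 * n := fun n => rfl
  have h2 : ∀ n : ℕ, Encodable.encode (Int.negSucc n) = 2 * n + 1 := fun n => rfl
  cases z with
  | ofNat n => rw [h1]; simp
  | negSucc n => rw [h2]; simp

theorem primrec_toNat_neg : Primrec fun z : ℤ => (-z).toNat := by
  have : Primrec fun z : ℤ =>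
      cond (Encodable.encode z).bodd ((Encodable.encode z).div2 + 1) 0 :=
    .cond (nat_bodd.comp .encode) (succ.comp (nat_div2.comp .encode)) (.const 0)
  refine this.of_eq fun z => ?_
  have h1 : ∀ n : ℕ, Encodable.encode (Int.ofNat n) = 2 * n := fun n => rfl
  have h2 : ∀ n : ℕ, Encodable.encode (Int.negSucc n) = 2 * n + 1 := fun n => rfl
  cases z with
  | ofNat n => rw [h1]; simp
  | negSucc n => rw [h2]; simp

theorem primrec_ofFrac : Primrec ofFrac :=
  (primrec_toNat.comp fst).pair ((primrec_toNat_neg.comp fst).pair (Primrec.pred.comp snd))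

end Primrec

end Fr

/-! ### The test of certificates is primitive recursive -/

/-- A coded pair of weights or of coefficients. -/
abbrev FrPair : Type := Fr × Fr

def FrPair.val (c : FrPair) : ℚ × ℚ := (c.1.val, c.2.val)

theorem FrPair.exists_val_eq (q : ℚ × ℚ) : ∃ x : FrPair, x.val = q := by
  obtain ⟨a, ha⟩ := Fr.exists_val_eq q.1
  obtain ⟨b, hb⟩ := Fr.exists_val_eq q.2
  exact ⟨(a, b), Prod.ext ha hb⟩

/-- A pair of states, one of each automaton. -/
abbrev PairState : Type := ℕ × ℕ

/-- An edge of a coded cost graph: source, target, and the two weights. -/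
abbrev CodedEdge : Type := PairState × PairState × FrPair

/-- A cost graph as finite data: the two discount factors, the list of initial states, and the
list of edges. -/
abbrev CodedGraph : Type := FrPair × List PairState × List CodedEdge

/-- An entry of a certificate: a state, the coefficients of a potential, and a flag. -/
abbrev CodedNode : Type := PairState × FrPair × Bool

def CodedNode.val (c : CodedNode) : PairState × (ℚ × ℚ) × Bool := (c.1, c.2.1.val, c.2.2)

namespace CodedGraph

/-- The cost graph that the data describe. -/
def toGraph (G : CodedGraph) : CostGraph PairState where
  α := G.1.1.val
  β := G.1.2.val
  init := {q | q ∈ G.2.1}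
  edge := (fun e : CodedEdge => (e.1, e.2.1, FrPair.val e.2.2)) '' {e | e ∈ G.2.2}

/-- The powers of the two discount factors. -/
def pows (G : CodedGraph) (n : ℕ) : FrPair :=
  Nat.rec ((1, 0, 0), (1, 0, 0)) (fun _ P => (Fr.mul P.1 G.1.1, Fr.mul P.2 G.1.2)) n

theorem val_pows (G : CodedGraph) (n : ℕ) :
    (G.pows n).val = (G.toGraph.α ^ n, G.toGraph.β ^ n) := by
  induction n with
  | zero => simp [pows, FrPair.val, Fr.val_one]
  | succ n ih =>
    have h : G.pows (n + 1) = (Fr.mul (G.pows n).1 G.1.1, Fr.mul (G.pows n).2 G.1.2) := rfl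
    simp only [FrPair.val, Prod.mk.injEq] at ih
    simp only [h, FrPair.val, Fr.val_mul, ih, pow_succ, toGraph]

/-- The potential with coefficients `c`, where `P` holds the powers of the discount factors. -/
def potF (P c : FrPair) : Fr := Fr.add (Fr.mul P.1 c.1) (Fr.neg (Fr.mul P.2 c.2))

theorem val_potF (G : CodedGraph) (n : ℕ) (c : FrPair) :
    (potF (G.pows n) c).val = pot G.toGraph.α G.toGraph.β n c.val := by
  have h := G.val_pows n
  simp only [FrPair.val, Prod.mk.injEq] at h
  simp only [potF, Fr.val_add, Fr.val_neg, Fr.val_mul, h, pot, FrPair.val, sub_eq_add_neg]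

/-- All extensions of the walks in `l`, which have length `k`, by one step. -/
def extend (G : CodedGraph) (k : ℕ) (l : List (PairState × Fr)) : List (PairState × Fr) :=
  l.flatMap fun y => G.2.2.filterMap fun e =>
    if e.1 = y.1 then some (e.2.1, Fr.add y.2 (potF (G.pows k) e.2.2)) else none

/-- The end states and the costs of all walks of length `n`. -/
def walks (G : CodedGraph) (n : ℕ) : List (PairState × Fr) :=
  Nat.rec (G.2.1.map fun q => (q, ((0, 0, 0) : Fr))) (fun k l => G.extend k l) n

theorem walk_iff (G : CodedGraph) (n : ℕ) (q : PairState) (x : ℚ) :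
    G.toGraph.Walk n q x ↔ ∃ y, (q, y) ∈ G.walks n ∧ y.val = x := by
  constructor
  · intro h
    induction h with
    | @start q h =>
      exact ⟨(0, 0, 0), List.mem_map.2 ⟨q, h, rfl⟩, Fr.val_zero⟩
    | @step n p q x w h he ih =>
      obtain ⟨y, hy, rfl⟩ := ih
      obtain ⟨⟨p', q', w'⟩, he, heq⟩ := he
      simp only [Prod.mk.injEq] at heq
      obtain ⟨rfl, rfl, rfl⟩ := heq
      refine ⟨Fr.add y (potF (G.pows n) w'), ?_, by rw [Fr.val_add, val_potF]⟩
      exact List.mem_flatMap.2 ⟨(p', y), hy, List.mem_filterMap.2 ⟨_, he, by simp⟩⟩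
  · rintro ⟨y, hy, rfl⟩
    induction n generalizing q y with
    | zero =>
      obtain ⟨p, hp, heq⟩ := List.mem_map.1 hy
      simp only [Prod.mk.injEq] at heq
      obtain ⟨rfl, rfl⟩ := heq
      rw [Fr.val_zero]
      exact .start hp
    | succ n ih =>
      obtain ⟨⟨p, z⟩, hz, h⟩ := List.mem_flatMap.1 hy
      obtain ⟨⟨p', q', w⟩, he, h⟩ := List.mem_filterMap.1 h
      split_ifs at h with hpp
      simp only [Option.some.injEq, Prod.mk.injEq] at h hpp
      obtain ⟨rfl, rfl⟩ := h
      subst hpp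
      rw [Fr.val_add, val_potF]
      exact .step (ih _ _ hz) ⟨_, he, rfl⟩

/-- The test for `CostGraph.NonnegFrom`, justified by `pow_mul_le_pow_mul_iff`.
Here `ab` holds the discount factors and `P` their powers. -/
def nonnegF (ab P c : FrPair) : Prop :=
  Fr.le (Fr.mul P.2 c.2) (Fr.mul P.1 c.1) ∧
    (Fr.le ab.2 ab.1 ∧ Fr.le (0, 0, 0) c.1 ∨ Fr.le ab.1 ab.2 ∧ Fr.le c.2 (0, 0, 0))

/-- The test for `CostGraph.PosFrom`. -/
def posF (ab P c : FrPair) : Prop :=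
  nonnegF ab P c ∧ ¬ Fr.le (Fr.mul P.1 c.1) (Fr.mul P.2 c.2)

theorem nonnegF_iff (G : CodedGraph) (hα : 0 < G.toGraph.α) (hβ : 0 < G.toGraph.β) (N : ℕ)
    (c : FrPair) : nonnegF G.1 (G.pows N) c ↔ G.toGraph.NonnegFrom N c.val := by
  have h := G.val_pows N
  simp only [FrPair.val, Prod.mk.injEq] at h
  simp only [nonnegF, Fr.le_iff, Fr.val_mul, h, Fr.val_zero]
  refine (pow_mul_le_pow_mul_iff hα hβ).symm.trans ?_
  simp only [CostGraph.NonnegFrom, pot, sub_nonneg, FrPair.val]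

theorem posF_iff (G : CodedGraph) (hα : 0 < G.toGraph.α) (hβ : 0 < G.toGraph.β) (N : ℕ)
    (c : FrPair) : posF G.1 (G.pows N) c ↔ G.toGraph.PosFrom N c.val := by
  rw [posF, nonnegF_iff G hα hβ]
  have h := G.val_pows N
  simp only [FrPair.val, Prod.mk.injEq] at h
  simp only [Fr.le_iff, Fr.val_mul, h, CostGraph.PosFrom, CostGraph.NonnegFrom, pot, sub_nonneg,
    sub_pos, FrPair.val]
  exact ⟨fun h => pow_mul_lt_pow_mul_of_not_le hα hβ h.1 h.2,
    fun h => ⟨fun n hn => (h n hn).le, not_le.2 (h N le_rfl)⟩⟩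

def negF (c : FrPair) : FrPair := (Fr.neg c.1, Fr.neg c.2)

theorem val_negF (c : FrPair) : (negF c).val = -c.val := by
  simp [negF, FrPair.val, Fr.val_neg]

/-- The counterpart of `CostGraph.slack`. -/
def slackF (ab c w c' : FrPair) : FrPair :=
  (Fr.add (Fr.add w.1 (Fr.mul ab.1 c'.1)) (Fr.neg c.1),
    Fr.add (Fr.add w.2 (Fr.mul ab.2 c'.2)) (Fr.neg c.2))

theorem val_slackF (G : CodedGraph) (c w c' : FrPair) :
    (slackF G.1 c w c').val = G.toGraph.slack c.val w.val c'.val := by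
  simp [slackF, FrPair.val, Fr.val_neg, Fr.val_add, Fr.val_mul, CostGraph.slack, pullback, toGraph,
    sub_eq_add_neg]

/-- The test for `CostGraph.IsCertificate`; the number `K` is the length of an attaining walk, if
there is one. -/
def certF (G : CodedGraph) (v : Fr) (att : Bool) (N K : ℕ) (C : List CodedNode) : Prop :=
  (1 ≤ N ∧ ∀ q ∈ G.2.1, ∃ c ∈ C, c.1 = q) ∧
  (∀ c ∈ C, nonnegF G.1 (G.pows N) (negF c.2.1) ∧
    (c.2.2 = true → posF G.1 (G.pows N) (negF c.2.1))) ∧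
  (∀ c ∈ C, ∀ e ∈ G.2.2, e.1 = c.1 → ∃ c' ∈ C, c'.1 = e.2.1 ∧
    nonnegF G.1 (G.pows N) (slackF G.1 c.2.1 e.2.2 c'.2.1) ∧
    (c.2.2 = true → c'.2.2 = true ∨
      posF G.1 (G.pows N) (slackF G.1 c.2.1 e.2.2 c'.2.1))) ∧
  (∀ c ∈ C, c.2.2 = true → ∃ e ∈ G.2.2, e.1 = c.1 ∧ ∃ c' ∈ C, c'.1 = e.2.1 ∧
    c'.2.2 = true ∧ nonnegF G.1 (G.pows N) (negF (slackF G.1 c.2.1 e.2.2 c'.2.1))) ∧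
  (∀ k < N, 1 ≤ k → ∀ y ∈ G.walks k, Fr.le v y.2 ∧ (att = false → ¬ Fr.le y.2 v)) ∧
  (∀ y ∈ G.walks N, ∃ c ∈ C, c.1 = y.1 ∧ Fr.le v (Fr.add y.2 (potF (G.pows N) c.2.1)) ∧
    (att = false → c.2.2 = true ∨ ¬ Fr.le (Fr.add y.2 (potF (G.pows N) c.2.1)) v)) ∧
  (att = true → 1 ≤ K ∧ ∃ y ∈ G.walks K, Fr.le y.2 v) ∧
  (att = false → ∃ y ∈ G.walks N, ∃ c ∈ C, c.1 = y.1 ∧ c.2.2 = true ∧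
    Fr.le (Fr.add y.2 (potF (G.pows N) c.2.1)) v)

theorem exists_certF_iff (G : CodedGraph) (hα : 0 < G.toGraph.α) (hβ : 0 < G.toGraph.β)
    (v : Fr) (att : Bool) (N : ℕ) (C : List CodedNode) :
    (∃ K, certF G v att N K C) ↔
      G.toGraph.IsCertificate v.val att N (CodedNode.val '' {c | c ∈ C}) := by
  have hw : ∀ k (P : PairState → ℚ → Prop), (∀ q x, G.toGraph.Walk k q x → P q x) ↔
      ∀ y ∈ G.walks k, P y.1 y.2.val := by
    intro k P
    simp only [walk_iff]
    exact ⟨fun h y hy => h _ _ ⟨_, hy, rfl⟩, by rintro h q _ ⟨y, hy, rfl⟩; exact h _ hy⟩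
  have hw' : ∀ k (P : PairState → ℚ → Prop), (∃ q x, G.toGraph.Walk k q x ∧ P q x) ↔
      ∃ y ∈ G.walks k, P y.1 y.2.val := by
    intro k P
    simp only [walk_iff]
    exact ⟨by rintro ⟨q, _, ⟨y, hy, rfl⟩, h⟩; exact ⟨_, hy, h⟩,
      fun ⟨y, hy, h⟩ => ⟨_, _, ⟨_, hy, rfl⟩, h⟩⟩
  have h1 : ∀ q, q ∈ G.toGraph.init ↔ q ∈ G.2.1 := fun q => Iff.rfl
  have h2 : G.toGraph.edge = (fun e : CodedEdge => (e.1, e.2.1, FrPair.val e.2.2)) ''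
    {e | e ∈ G.2.2} := rfl
  have hcast : G.toGraph.IsCertificate v.val att N (CodedNode.val '' {c | c ∈ C}) ↔
      (_ ∧ _) ∧ _ ∧ _ ∧ _ ∧ _ ∧ _ ∧ _ ∧ _ :=
    ⟨fun h => ⟨⟨h.one_le, h.covers⟩, h.halt, h.edge, h.tight,
      h.short, h.long, h.attained, h.approached⟩,
      fun h => ⟨h.1.1, h.1.2, h.2.1, h.2.2.1, h.2.2.2.1,
        h.2.2.2.2.1, h.2.2.2.2.2.1, h.2.2.2.2.2.2.1, h.2.2.2.2.2.2.2⟩⟩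
  rw [hcast]
  -- Only the clause on attaining walks depends on `K`.
  have hK : ∀ A B : Prop, (∃ K, A ∧ (att = true → 1 ≤ K ∧ ∃ y ∈ G.walks K, Fr.le y.2 v) ∧ B) ↔
      A ∧ (att = true → ∃ k ≥ 1, ∃ y ∈ G.walks k, y.2.val ≤ v.val) ∧ B := by
    intro A B
    simp only [Fr.le_iff]
    constructor
    · rintro ⟨K, ha, hk, hb⟩
      exact ⟨ha, fun h => ⟨K, hk h⟩, hb⟩
    · rintro ⟨ha, hk, hb⟩
      by_cases h : att = true
      · obtain ⟨k, hk⟩ := hk h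
        exact ⟨k, ha, fun _ => hk, hb⟩
      · exact ⟨0, ha, fun h' => absurd h' h, hb⟩
  have hassoc := hK
  simp only [certF, ← and_assoc] at hassoc ⊢
  rw [hassoc]
  simp only [and_assoc, hw, hw', h1, h2, Set.forall_mem_image, Set.exists_mem_image,
    Set.mem_ofPred_eq, CodedNode.val, nonnegF_iff G hα hβ, posF_iff G hα hβ, val_negF, val_slackF,
    Fr.le_iff, Fr.val_add, val_potF, not_le]

section Primrec

open Primrec

theorem primrec_pows : Primrec₂ pows := by
  refine (nat_rec (f := fun _ : CodedGraph => (((1, 0, 0), (1, 0, 0)) : FrPair))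
    (g := fun G p => (Fr.mul p.2.1 G.1.1, Fr.mul p.2.2 G.1.2)) (.const _) ?_)
  have hα : Primrec fun x : CodedGraph × ℕ × FrPair => x.1.1.1 := fst.comp (fst.comp fst)
  have hβ : Primrec fun x : CodedGraph × ℕ × FrPair => x.1.1.2 := snd.comp (fst.comp fst)
  have hP : Primrec fun x : CodedGraph × ℕ × FrPair => x.2.2 := snd.comp snd
  exact (Fr.primrec_mul.comp (fst.comp hP) hα).pair (Fr.primrec_mul.comp (snd.comp hP) hβ)

theorem primrec_potF : Primrec₂ potF :=
  Fr.primrec_add.comp (Fr.primrec_mul.comp (fst.comp fst) (fst.comp snd))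
    (Fr.primrec_neg.comp (Fr.primrec_mul.comp (snd.comp fst) (snd.comp snd)))

theorem primrec_extend :
    Primrec fun x : CodedGraph × ℕ × List (PairState × Fr) => x.1.extend x.2.1 x.2.2 := by
  let X := CodedGraph × ℕ × List (PairState × Fr)
  let T := (X × PairState × Fr) × CodedEdge
  have hG : Primrec fun t : T => t.1.1.1 := fst.comp (fst.comp fst)
  have hk : Primrec fun t : T => t.1.1.2.1 := fst.comp (snd.comp (fst.comp fst))
  have hy : Primrec fun t : T => t.1.2 := snd.comp fst
  have he : Primrec fun t : T => t.2 := snd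
  have hE : Primrec fun x : X × PairState × Fr => x.1.1.2.2 :=
    snd.comp (snd.comp (fst.comp fst))
  have hs : Primrec fun t : T =>
      if t.2.1 = t.1.2.1 then
        some (t.2.2.1, Fr.add t.1.2.2 (potF (t.1.1.1.pows t.1.1.2.1) t.2.2.2)) else none :=
    Primrec.ite (.eq_of (fst.comp he) (fst.comp hy))
      (option_some.comp ((fst.comp (snd.comp he)).pair (Fr.primrec_add.comp (snd.comp hy)
      (primrec_potF.comp (primrec_pows.comp hG hk) (snd.comp (snd.comp he)))))) (.const none)
  exact list_flatMap (snd.comp snd) (listFilterMap hE hs.to₂).to₂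

theorem primrec_walks : Primrec₂ walks := by
  have h0 : Primrec fun G : CodedGraph => G.2.1.map fun q => (q, ((0, 0, 0) : Fr)) :=
    list_map (fst.comp snd) (Primrec.pair snd (.const ((0, 0, 0) : Fr))).to₂
  have h1 : Primrec₂ fun (G : CodedGraph) (p : ℕ × List (PairState × Fr)) => G.extend p.1 p.2 :=
    primrec_extend
  have h2 := nat_rec h0 h1
  refine h2.of_eq fun G n => ?_
  induction n with
  | zero => rfl
  | succ n ih => exact congrArg (G.extend n) ih

theorem primrec_negF : Primrec negF :=
  (Fr.primrec_neg.comp fst).pair (Fr.primrec_neg.comp snd)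

variable {τ : Type*} [Primcodable τ]

theorem primrecPred_nonnegF {ab P c : τ → FrPair} (hab : Primrec ab) (hP : Primrec P)
    (hc : Primrec c) : PrimrecPred fun t => nonnegF (ab t) (P t) (c t) :=
  (Fr.primrec_le.comp (Fr.primrec_mul.comp (snd.comp hP) (snd.comp hc))
    (Fr.primrec_mul.comp (fst.comp hP) (fst.comp hc))).and
  (((Fr.primrec_le.comp (snd.comp hab) (fst.comp hab)).and
    (Fr.primrec_le.comp (.const _) (fst.comp hc))).or
  ((Fr.primrec_le.comp (fst.comp hab) (snd.comp hab)).and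
    (Fr.primrec_le.comp (snd.comp hc) (.const _))))

theorem primrecPred_posF {ab P c : τ → FrPair} (hab : Primrec ab) (hP : Primrec P)
    (hc : Primrec c) : PrimrecPred fun t => posF (ab t) (P t) (c t) :=
  (primrecPred_nonnegF hab hP hc).and
    (Fr.primrec_le.comp (Fr.primrec_mul.comp (fst.comp hP) (fst.comp hc))
      (Fr.primrec_mul.comp (snd.comp hP) (snd.comp hc))).not

theorem primrec_slackF {ab c w c' : τ → FrPair} (hab : Primrec ab) (hc : Primrec c)
    (hw : Primrec w) (hc' : Primrec c') :
    Primrec fun t => slackF (ab t) (c t) (w t) (c' t) :=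
  (Fr.primrec_add.comp (Fr.primrec_add.comp (fst.comp hw)
    (Fr.primrec_mul.comp (fst.comp hab) (fst.comp hc'))) (Fr.primrec_neg.comp (fst.comp hc))).pair
  (Fr.primrec_add.comp (Fr.primrec_add.comp (snd.comp hw)
    (Fr.primrec_mul.comp (snd.comp hab) (snd.comp hc'))) (Fr.primrec_neg.comp (snd.comp hc)))

theorem primrecPred_certF {G : τ → CodedGraph} {v : τ → Fr} {att : τ → Bool} {N K : τ → ℕ}
    {C : τ → List CodedNode} (hG : Primrec G) (hv : Primrec v) (hatt : Primrec att)
    (hN : Primrec N) (hK : Primrec K) (hC : Primrec C) :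
    PrimrecPred fun t => certF (G t) (v t) (att t) (N t) (K t) (C t) := by
  have hP : Primrec fun t => (G t).pows (N t) := primrec_pows.comp hG hN
  have hab : Primrec fun t => (G t).1 := fst.comp hG
  have hI : Primrec fun t => (G t).2.1 := fst.comp (snd.comp hG)
  have hE : Primrec fun t => (G t).2.2 := snd.comp (snd.comp hG)
  have hW : Primrec fun t => (G t).walks (N t) := primrec_walks.comp hG hN
  refine .and (.and (nat_le.comp (.const 1) hN) ?_) (.and ?_ (.and ?_ (.and ?_ (.and ?_ (.and ?_
    (.and ?_ ?_))))))
  · exact .ball hI (.bex (hC.comp fst) (.eq_of (fst.comp snd) (snd.comp fst)))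
  · have hc : Primrec fun t : τ × CodedNode => negF t.2.2.1 :=
      primrec_negF.comp (fst.comp (snd.comp snd))
    exact .ball hC (.and (primrecPred_nonnegF (hab.comp fst) (hP.comp fst) hc)
      (.imp (.eq_of (snd.comp (snd.comp snd)) (.const true))
        (primrecPred_posF (hab.comp fst) (hP.comp fst) hc)))
  · let T := ((τ × CodedNode) × CodedEdge) × CodedNode
    have ht : Primrec fun t : T => t.1.1.1 := fst.comp (fst.comp fst)
    have hc : Primrec fun t : T => t.1.1.2 := snd.comp (fst.comp fst)
    have he : Primrec fun t : T => t.1.2 := snd.comp fst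
    have hc' : Primrec fun t : T => t.2 := snd
    have hs := primrec_slackF (hab.comp ht) (fst.comp (snd.comp hc)) (snd.comp (snd.comp he))
      (fst.comp (snd.comp hc'))
    refine .ball hC (.ball (hE.comp fst) (.imp (.eq_of (fst.comp snd) (fst.comp (snd.comp fst)))
      (.bex (hC.comp (fst.comp fst)) ?_)))
    exact .and (.eq_of (fst.comp hc') (fst.comp (snd.comp he)))
      (.and (primrecPred_nonnegF (hab.comp ht) (hP.comp ht) hs)
        (.imp (.eq_of (snd.comp (snd.comp hc)) (.const true))
          (.or (.eq_of (snd.comp (snd.comp hc')) (.const true))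
            (primrecPred_posF (hab.comp ht) (hP.comp ht) hs))))
  · let T := ((τ × CodedNode) × CodedEdge) × CodedNode
    have ht : Primrec fun t : T => t.1.1.1 := fst.comp (fst.comp fst)
    have hc : Primrec fun t : T => t.1.1.2 := snd.comp (fst.comp fst)
    have he : Primrec fun t : T => t.1.2 := snd.comp fst
    have hc' : Primrec fun t : T => t.2 := snd
    have hs := primrec_slackF (hab.comp ht) (fst.comp (snd.comp hc)) (snd.comp (snd.comp he))
      (fst.comp (snd.comp hc'))
    refine .ball hC (.imp (.eq_of (snd.comp (snd.comp snd)) (.const true)) (.bex (hE.comp fst)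
      (.and (.eq_of (fst.comp snd) (fst.comp (snd.comp fst)))
      (.bex (hC.comp (fst.comp fst)) ?_))))
    exact .and (.eq_of (fst.comp hc') (fst.comp (snd.comp he)))
      (.and (.eq_of (snd.comp (snd.comp hc')) (.const true))
        (primrecPred_nonnegF (hab.comp ht) (hP.comp ht) (primrec_negF.comp hs)))
  · refine .ball_lt hN (.imp (nat_le.comp (.const 1) snd)
      (.ball (primrec_walks.comp (hG.comp fst) snd) ?_))
    have ht : Primrec fun t : (τ × ℕ) × PairState × Fr => t.1.1 := fst.comp fst
    have hy : Primrec fun t : (τ × ℕ) × PairState × Fr => t.2.2 := snd.comp snd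
    exact .and (Fr.primrec_le.comp (hv.comp ht) hy)
      (.imp (.eq_of (hatt.comp ht) (.const false)) (Fr.primrec_le.comp hy (hv.comp ht)).not)
  · have ht : Primrec fun t : (τ × PairState × Fr) × CodedNode => t.1.1 := fst.comp fst
    have hy : Primrec fun t : (τ × PairState × Fr) × CodedNode => t.1.2 := snd.comp fst
    have hc : Primrec fun t : (τ × PairState × Fr) × CodedNode => t.2 := snd
    have hs := Fr.primrec_add.comp (snd.comp hy)
      (primrec_potF.comp (hP.comp ht) (fst.comp (snd.comp hc)))
    exact .ball hW (.bex (hC.comp fst) (.and (.eq_of (fst.comp hc) (fst.comp hy))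
      (.and (Fr.primrec_le.comp (hv.comp ht) hs)
        (.imp (.eq_of (hatt.comp ht) (.const false))
          (.or (.eq_of (snd.comp (snd.comp hc)) (.const true))
            (Fr.primrec_le.comp hs (hv.comp ht)).not)))))
  · exact .imp (.eq_of hatt (.const true)) (.and (nat_le.comp (.const 1) hK)
      (.bex (primrec_walks.comp hG hK) (Fr.primrec_le.comp (snd.comp snd) (hv.comp fst))))
  · have ht : Primrec fun t : (τ × PairState × Fr) × CodedNode => t.1.1 := fst.comp fst
    have hy : Primrec fun t : (τ × PairState × Fr) × CodedNode => t.1.2 := snd.comp fst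
    have hc : Primrec fun t : (τ × PairState × Fr) × CodedNode => t.2 := snd
    have hs := Fr.primrec_add.comp (snd.comp hy)
      (primrec_potF.comp (hP.comp ht) (fst.comp (snd.comp hc)))
    exact .imp (.eq_of hatt (.const false)) (.bex hW (.bex (hC.comp fst)
      (.and (.eq_of (fst.comp hc) (fst.comp hy))
        (.and (.eq_of (snd.comp (snd.comp hc)) (.const true))
          (Fr.primrec_le.comp hs (hv.comp ht))))))

end Primrec

end CodedGraph

/-! ### Runs, and walks in the synchronous product -/

namespace NDA

variable {σ Q Q' : Type*}

/-- `A.Ends u q x`: some run of `A` on the word `u` ends in the state `q` and has the value `x`. -/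
inductive Ends (A : NDA σ Q) : List σ → Q → ℚ → Prop
  | nil {q} (h : q ∈ A.init) : Ends A [] q 0
  | snoc {u p x a q} (h : Ends A u p x) (ht : (p, a, q) ∈ A.trans) :
      Ends A (u ++ [a]) q (x + A.weight ⟨_, ht⟩ / A.discount ^ u.length)

theorem weight_congr (A : NDA σ Q) {s t : Q × σ × Q} (h : s = t) (hs : s ∈ A.trans)
    (ht : t ∈ A.trans) : A.weight ⟨s, hs⟩ = A.weight ⟨t, ht⟩ := by
  subst h; rfl

/-- Every run gives rise to a chain of its prefixes. -/
theorem ends_of_run {A : NDA σ Q} {u : List σ} (r : A.Run u) :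
    A.Ends u (r.state (Fin.last _)) r.value := by
  have key : ∀ k (hk : k ≤ u.length), A.Ends (u.take k) (r.state ⟨k, by omega⟩)
      (∑ i : Fin k, A.weight ⟨_, r.step ⟨i, by omega⟩⟩ / A.discount ^ (i : ℕ)) := by
    intro k
    induction k with
    | zero =>
      intro _
      simpa using Ends.nil r.start
    | succ k ih =>
      intro hk
      have h := (ih (by omega)).snoc (r.step ⟨k, hk⟩)
      rw [Fin.sum_univ_castSucc]
      have hu : u.take (k + 1) = u.take k ++ [u.get ⟨k, hk⟩] := by
        rw [List.take_succ_eq_append_getElem hk]; rfl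
      have hlen : (u.take k).length = k := by simp; omega
      rw [hlen, ← hu] at h
      exact h
  have h := key u.length le_rfl
  rw [List.take_length] at h
  exact h

theorem exists_run_of_ends {A : NDA σ Q} {u : List σ} {q : Q} {x : ℚ} (h : A.Ends u q x) :
    ∃ r : A.Run u, r.state (Fin.last _) = q ∧ r.value = x := by
  induction h with
  | @nil q h => exact ⟨⟨fun _ => q, h, fun i => i.elim0⟩, rfl, by simp [Run.value]⟩
  | @snoc u p x a q _ ht ih =>
    obtain ⟨r, hr, rfl⟩ := ih
    have hlen : (u ++ [a]).length = u.length + 1 := by simp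
    let s : Fin ((u ++ [a]).length + 1) → Q := fun i =>
      if h : i.1 < u.length + 1 then r.state ⟨i, h⟩ else q
    -- The transitions of the extended run are those of `r` followed by `(p, a, q)`.
    have hold : ∀ (i : ℕ) (hi : i < u.length),
        (s ⟨i, by omega⟩, (u ++ [a]).get ⟨i, by omega⟩, s ⟨i + 1, by omega⟩) =
          (r.state ⟨i, by omega⟩, u.get ⟨i, hi⟩, r.state ⟨i + 1, by omega⟩) := by
      intro i hi
      have h1 : i < u.length + 1 := by omega
      have h2 : i + 1 < u.length + 1 := by omega
      simp only [s, h1, h2, dif_pos]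
      simp [hi]
    have hnew : (s ⟨u.length, by omega⟩, (u ++ [a]).get ⟨u.length, by omega⟩,
        s ⟨u.length + 1, by omega⟩) = (p, a, q) := by
      have h1 : ¬ u.length + 1 < u.length + 1 := by omega
      have h2 : r.state ⟨u.length, by omega⟩ = p := hr
      simp [s, h2]
    have hstep : ∀ (i : ℕ) (hi : i < (u ++ [a]).length),
        (s ⟨i, by omega⟩, (u ++ [a]).get ⟨i, hi⟩, s ⟨i + 1, by omega⟩) ∈ A.trans := by
      intro i hi
      rcases Nat.lt_or_ge i u.length with h | h
      · rw [hold i h]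
        exact r.step ⟨i, h⟩
      · obtain rfl : i = u.length := by omega
        rw [hnew]
        exact ht
    refine ⟨⟨s, by simpa [s] using r.start, fun i => hstep i i.2⟩, by simp [s], ?_⟩
    rw [Run.value, ← (finCongr hlen.symm).sum_comp, Fin.sum_univ_castSucc]
    congr 1
    · exact Finset.sum_congr rfl fun i _ =>
        congrArg₂ (· / ·) (A.weight_congr (hold i i.2) _ (r.step i)) rfl
    · exact congrArg₂ (· / ·) (A.weight_congr hnew _ ht) rfl

theorem nonempty_run_iff {A : NDA σ Q} {u : List σ} : Nonempty (A.Run u) ↔ ∃ q x, A.Ends u q x :=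
  ⟨fun ⟨r⟩ => ⟨_, _, ends_of_run r⟩, fun ⟨_, _, h⟩ => ⟨(exists_run_of_ends h).choose⟩⟩

instance [Finite Q] (A : NDA σ Q) (u : List σ) : Finite (A.Run u) :=
  Finite.of_injective Run.state fun r s h => by cases r; cases s; cases h; rfl

theorem value_eq_top {A : NDA σ Q} {u : List σ} (h : ¬ ∃ q x, A.Ends u q x) : A.value u = ⊤ := by
  have : IsEmpty (A.Run u) := not_nonempty_iff.1 (mt nonempty_run_iff.1 h)
  exact iInf_of_empty _

theorem exists_ends_value_eq [Finite Q] {A : NDA σ Q} {u : List σ} (h : ∃ q x, A.Ends u q x) :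
    ∃ q x, A.Ends u q x ∧ A.value u = ((x : ℝ) : EReal) := by
  have := nonempty_run_iff.2 h
  obtain ⟨r, hr⟩ := exists_eq_ciInf_of_finite (f := fun r : A.Run u => ((r.value : ℝ) : EReal))
  exact ⟨_, _, ends_of_run r, hr.symm⟩

theorem value_le {A : NDA σ Q} {u : List σ} {q : Q} {x : ℚ} (h : A.Ends u q x) :
    A.value u ≤ ((x : ℝ) : EReal) := by
  obtain ⟨r, -, rfl⟩ := exists_run_of_ends h
  exact iInf_le _ r

theorem ends_snoc {A : NDA σ Q} {u : List σ} {a : σ} {q : Q} {x : ℚ} (h : A.Ends (u ++ [a]) q x) :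
    ∃ p y, ∃ ht : (p, a, q) ∈ A.trans, A.Ends u p y ∧
      x = y + A.weight ⟨_, ht⟩ / A.discount ^ u.length := by
  generalize hw : u ++ [a] = w at h
  cases h with
  | nil => simp at hw
  | snoc h ht =>
    obtain ⟨rfl, h1⟩ := List.append_inj' hw rfl
    obtain rfl : a = _ := by simpa using h1
    exact ⟨_, _, ht, h, rfl⟩

theorem Ends.eq_init {A : NDA σ Q} {q : Q} {x : ℚ} (h : A.Ends [] q x) : q ∈ A.init ∧ x = 0 := by
  generalize hw : [] = w at h
  cases h with
  | nil h => exact ⟨h, rfl⟩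
  | snoc => simp at hw

theorem IsDeterministic.ends_unique {D : NDA σ Q} (hD : D.IsDeterministic) {u : List σ} {p q : Q}
    {x y : ℚ} (hp : D.Ends u p x) (hq : D.Ends u q y) : p = q ∧ x = y := by
  induction hp generalizing q y with
  | nil h =>
    obtain ⟨h', rfl⟩ := hq.eq_init
    exact ⟨hD.1.unique h h', rfl⟩
  | snoc _ ht ih =>
    obtain ⟨p', y', ht', h', rfl⟩ := ends_snoc hq
    obtain ⟨rfl, rfl⟩ := ih h'
    obtain rfl := hD.2 _ _ _ _ ht ht'
    exact ⟨rfl, rfl⟩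

theorem IsDeterministic.value_eq {D : NDA σ Q} [Finite Q] (hD : D.IsDeterministic) {u : List σ}
    {q : Q} {x : ℚ} (h : D.Ends u q x) : D.value u = ((x : ℝ) : EReal) := by
  obtain ⟨p, y, h', hy⟩ := exists_ends_value_eq ⟨q, x, h⟩
  rw [hy, (hD.ends_unique h h').2]

theorem exists_trans_of_ends {A : NDA σ Q} {u : List σ} {q : Q} {x : ℚ} (hu : u ≠ [])
    (h : A.Ends u q x) : ∃ p ∈ A.init, ∃ a p', (p, a, p') ∈ A.trans := by
  induction h with
  | nil => exact absurd rfl hu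
  | @snoc u p x a q h ht ih =>
    rcases eq_or_ne u [] with rfl | hu'
    · exact ⟨p, h.eq_init.1, a, q, ht⟩
    · exact ih hu'

/-- The cost graph `H` is the synchronous product of `A` and `D`: a walk reads one word in both
automata, and the value of `D` is subtracted. -/
structure IsProduct {m n k : ℕ} (A : NDA (Fin m) (Fin n)) (D : NDA (Fin m) (Fin k))
    (H : CostGraph PairState) : Prop where
  α_eq : H.α = A.discount⁻¹
  β_eq : H.β = D.discount⁻¹
  mem_init : ∀ s, s ∈ H.init ↔ ∃ p ∈ A.init, ∃ q ∈ D.init, s = ((p : ℕ), (q : ℕ))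
  mem_edge : ∀ e, e ∈ H.edge ↔ ∃ (p : Fin n) (q : Fin k) (a : Fin m) (p' : Fin n) (q' : Fin k)
    (hA : (p, a, p') ∈ A.trans) (hD : (q, a, q') ∈ D.trans),
    e = (((p : ℕ), (q : ℕ)), ((p' : ℕ), (q' : ℕ)), (A.weight ⟨_, hA⟩, D.weight ⟨_, hD⟩))

theorem IsProduct.walk_iff {m n k : ℕ} {A : NDA (Fin m) (Fin n)} {D : NDA (Fin m) (Fin k)}
    {H : CostGraph PairState} (hH : IsProduct A D H) {l : ℕ} {s : PairState} {x : ℚ} :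
    H.Walk l s x ↔ ∃ u p q y z, A.Ends u p y ∧ D.Ends u q z ∧ u.length = l ∧
      s = ((p : ℕ), (q : ℕ)) ∧ x = y - z := by
  constructor
  · intro h
    induction h with
    | start h =>
      obtain ⟨p, hp, q, hq, rfl⟩ := (hH.mem_init _).1 h
      exact ⟨[], p, q, 0, 0, .nil hp, .nil hq, rfl, rfl, by simp⟩
    | step _ he ih =>
      obtain ⟨u, p, q, y, z, hy, hz, rfl, rfl, rfl⟩ := ih
      obtain ⟨p₁, q₁, a, p', q', hA, hD, heq⟩ := (hH.mem_edge _).1 he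
      simp only [Prod.mk.injEq] at heq
      obtain ⟨⟨h1, h2⟩, rfl, rfl⟩ := heq
      obtain rfl := Fin.ext h1
      obtain rfl := Fin.ext h2
      refine ⟨_, p', q', _, _, hy.snoc hA, hz.snoc hD, by simp, rfl, ?_⟩
      simp only [pot, hH.α_eq, hH.β_eq, inv_pow]
      ring
  · rintro ⟨u, p, q, y, z, hy, hz, rfl, rfl, rfl⟩
    induction hy generalizing q z with
    | nil hp =>
      obtain ⟨hq, rfl⟩ := hz.eq_init
      rw [sub_zero]
      exact .start ((hH.mem_init _).2 ⟨_, hp, q, hq, rfl⟩)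
    | @snoc u p y a p' hy hA ih =>
      obtain ⟨q₁, z₁, hD, hz₁, rfl⟩ := ends_snoc hz
      have h := (ih q₁ z₁ hz₁).step ((hH.mem_edge _).2 ⟨p, q₁, a, p', q, hA, hD, rfl⟩)
      rw [List.length_append, List.length_singleton]
      convert h using 1
      simp only [pot, hH.α_eq, hH.β_eq, inv_pow]
      ring

section

variable {m n k : ℕ} {A : NDA (Fin m) (Fin n)} {D : NDA (Fin m) (Fin k)}

/-- Without a transition from an initial state of `A`, every difference is `⊤`. -/
theorem eq_top_of_mem_diffSet (hD : D.IsDeterministic)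
    (hA : ¬ ∃ p ∈ A.init, ∃ a p', (p, a, p') ∈ A.trans) {x : EReal} (hx : x ∈ A.diffSet D) :
    x = ⊤ := by
  obtain ⟨u, hu, hrun, rfl⟩ := hx
  have hno : ¬ ∃ q x, A.Ends u q x := fun ⟨q, x, h⟩ => hA (exists_trans_of_ends hu h)
  rw [value_eq_top hno]
  rcases hrun with h | h
  · exact absurd (nonempty_run_iff.1 h) hno
  · obtain ⟨q, z, hz⟩ := nonempty_run_iff.1 h
    rw [hD.value_eq hz]
    exact EReal.top_sub_coe _

theorem diffSet_nonempty_iff (hA : ¬ ∃ p ∈ A.init, ∃ a p', (p, a, p') ∈ A.trans) :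
    (A.diffSet D).Nonempty ↔ ∃ q ∈ D.init, ∃ a q', (q, a, q') ∈ D.trans := by
  constructor
  · rintro ⟨_, u, hu, hrun, -⟩
    rcases hrun with h | h
    · obtain ⟨q, x, h⟩ := nonempty_run_iff.1 h
      exact absurd (exists_trans_of_ends hu h) hA
    · obtain ⟨q, x, h⟩ := nonempty_run_iff.1 h
      exact exists_trans_of_ends hu h
  · rintro ⟨q, hq, a, q', ht⟩
    exact ⟨_, [] ++ [a], by simp, Or.inr (nonempty_run_iff.2 ⟨_, _, (Ends.nil hq).snoc ht⟩), rfl⟩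

/-- If `A` can read a letter after a common word and `D` cannot, then the difference is `⊥`. -/
theorem bot_mem_diffSet (hD : D.IsDeterministic) {u : List (Fin m)} {p p' : Fin n} {q : Fin k}
    {y z : ℚ} {a : Fin m} (hy : A.Ends u p y) (hz : D.Ends u q z) (hA : (p, a, p') ∈ A.trans)
    (hstuck : ∀ q', (q, a, q') ∉ D.trans) : ⊥ ∈ A.diffSet D := by
  have hA' := hy.snoc hA
  refine ⟨u ++ [a], by simp, Or.inl (nonempty_run_iff.2 ⟨_, _, hA'⟩), ?_⟩
  have hno : ¬ ∃ q x, D.Ends (u ++ [a]) q x := by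
    rintro ⟨q', x, h⟩
    obtain ⟨q₁, z₁, ht, h', -⟩ := ends_snoc h
    obtain ⟨rfl, -⟩ := hD.ends_unique hz h'
    exact hstuck _ ht
  obtain ⟨_, x, -, hx⟩ := exists_ends_value_eq ⟨_, _, hA'⟩
  rw [value_eq_top hno, hx]
  exact (EReal.sub_top _).symm

/-- A walk need not follow an optimal run of `A`, so its cost only bounds the difference. -/
theorem IsProduct.exists_mem_diffSet_le {H : CostGraph PairState} (hH : IsProduct A D H)
    (hD : D.IsDeterministic) {l : ℕ} (hl : 1 ≤ l) {s : PairState} {x : ℚ} (hw : H.Walk l s x) :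
    ∃ y ∈ A.diffSet D, y ≤ ((x : ℝ) : EReal) := by
  obtain ⟨u, p, q, y, z, hy, hz, rfl, rfl, rfl⟩ := hH.walk_iff.1 hw
  refine ⟨_, ⟨u, by rintro rfl; simp at hl, Or.inl (nonempty_run_iff.2 ⟨_, _, hy⟩), rfl⟩, ?_⟩
  rw [hD.value_eq hz]
  push_cast
  exact EReal.sub_le_sub (value_le hy) le_rfl

/-- If `D` can always follow `A`, then the finite differences are costs of walks. -/
theorem IsProduct.exists_walk_of_mem_diffSet {H : CostGraph PairState} (hH : IsProduct A D H)
    (hD : D.IsDeterministic)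
    (hlive : ∀ (p : Fin n) (q : Fin k) l x, H.Walk l ((p : ℕ), (q : ℕ)) x → ∀ a p',
      (p, a, p') ∈ A.trans → ∃ q', (q, a, q') ∈ D.trans) {y : EReal} (hy : y ∈ A.diffSet D) :
    y = ⊤ ∨ ∃ l ≥ 1, ∃ s x, H.Walk l s x ∧ y = ((x : ℝ) : EReal) := by
  obtain ⟨u, hu, hrun, rfl⟩ := hy
  by_cases hA : ∃ q x, A.Ends u q x
  · obtain ⟨p, x, hx, hval⟩ := exists_ends_value_eq hA
    have hrunD : ∀ (u : List (Fin m)) p x, A.Ends u p x → ∃ q z, D.Ends u q z := by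
      intro u p x h
      induction h with
      | nil => exact ⟨_, _, .nil hD.1.choose_spec.1⟩
      | snoc h ht ih =>
        obtain ⟨q, z, hz⟩ := ih
        obtain ⟨q', hq'⟩ := hlive _ q _ _
          (hH.walk_iff.2 ⟨_, _, q, _, z, h, hz, rfl, rfl, rfl⟩) _ _ ht
        exact ⟨_, _, hz.snoc hq'⟩
    obtain ⟨q, z, hz⟩ := hrunD u p x hx
    refine Or.inr ⟨u.length, List.length_pos_iff.2 hu, _, x - z,
      hH.walk_iff.2 ⟨u, p, q, x, z, hx, hz, rfl, rfl, rfl⟩, ?_⟩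
    rw [hval, hD.value_eq hz]
    push_cast
    rfl
  · left
    rw [value_eq_top hA]
    rcases hrun with h | h
    · exact absurd (nonempty_run_iff.1 h) hA
    · obtain ⟨q, z, hz⟩ := nonempty_run_iff.1 h
      rw [hD.value_eq hz]
      exact EReal.top_sub_coe _

end

end NDA

/-! ### The search problem on descriptions of automata -/

namespace NDACode

/-- The test that a fraction is a discount factor greater than one. -/
def Proper (z : ℤ × ℕ) : Prop := 0 < z.2 ∧ z.2 < z.1.toNat

/-- The inverse of a positive fraction. -/
def invF (z : ℤ × ℕ) : Fr := (z.2, 0, z.1.toNat - 1)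

theorem Proper.val_invF {z : ℤ × ℕ} (h : Proper z) : (invF z).val = z.2 / z.1.toNat := by
  obtain ⟨k, hk⟩ := Nat.exists_eq_succ_of_ne_zero (show z.1.toNat ≠ 0 by have := h.2; omega)
  simp [invF, Fr.val, hk]

theorem Proper.invF_pos {z : ℤ × ℕ} (h : Proper z) : 0 < (invF z).val := by
  have h1 := h.1
  have h2 : 0 < z.1.toNat := h.1.trans h.2
  rw [h.val_invF]
  positivity

theorem Proper.invF_lt_one {z : ℤ × ℕ} (h : Proper z) : (invF z).val < 1 := by
  have h2 : (0 : ℚ) < z.1.toNat := by exact_mod_cast h.1.trans h.2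
  rw [h.val_invF, div_lt_one h2]
  exact_mod_cast h.2

theorem proper_ratCode {q : ℚ} (hq : 1 < q) : Proper (ratCode q) := by
  refine ⟨q.den_pos, ?_⟩
  have h1 : (q.den : ℤ) < q.num := by
    have := Rat.num_div_den q
    have hd : (0 : ℚ) < q.den := by exact_mod_cast q.den_pos
    have : (q.den : ℚ) < q.num := by
      rw [← this, one_lt_div hd] at hq
      exact hq
    exact_mod_cast this
  simp only [ratCode]
  omega

theorem val_invF_ratCode {q : ℚ} (hq : 1 < q) : (invF (ratCode q)).val = q⁻¹ := by
  rw [(proper_ratCode hq).val_invF]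
  have h : ((q.num.toNat : ℤ) : ℚ) = q.num := by
    rw [Int.toNat_of_nonneg (Rat.num_nonneg.2 (by linarith))]
  simp only [Int.cast_natCast] at h
  simp only [ratCode, h]
  conv_rhs => rw [← Rat.num_div_den q, inv_div]

/-- The synchronous product of two automata, where the second one contributes negative costs. -/
def product (x : NDACode × NDACode) : CodedGraph :=
  ((invF x.1.1, invF x.2.1),
    x.1.2.2.1.flatMap fun p => x.2.2.2.1.map fun q => (p, q),
    x.1.2.2.2.flatMap fun s => x.2.2.2.2.filterMap fun t =>
      if s.1.2.1 = t.1.2.1 then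
        some ((s.1.1, t.1.1), (s.1.2.2, t.1.2.2), (Fr.ofFrac s.2, Fr.ofFrac t.2))
      else none)

/-- The first automaton has a transition from the first component of `s` on a letter on which the
second automaton has none from the second component. -/
def Stuck (x : NDACode × NDACode) (s : PairState) : Prop :=
  ∃ e ∈ x.1.2.2.2, e.1.1 = s.1 ∧ ∀ t ∈ x.2.2.2.2, t.1.1 = s.2 → ¬ e.1.2.1 = t.1.2.1

/-- The automaton has a transition from an initial state. -/
def Starts (c : NDACode) : Prop := ∃ q ∈ c.2.2.1, ∃ e ∈ c.2.2.2, e.1.1 = q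

/-- What is searched for on an input: the answer, consisting of the infimum and of the bit that
tells whether it is attained, the two lengths `N` and `K` of `CodedGraph.certF`, and the entries of
a certificate. For the answer `-∞`, the second length is that of a walk to a stuck pair. -/
abbrev Witness : Type := (Option (Option (ℤ × ℕ)) × Bool) × (ℕ × ℕ) × List CodedNode

/-- The fraction in an answer, where `(0, 0)` stands for an infinite answer. -/
def fracOf (o : Option (Option (ℤ × ℕ))) : ℤ × ℕ := (o.getD none).getD (0, 0)

/-- The test of a witness. So that the search terminates on all inputs, it accepts everything on
inputs that do not describe a pair of automata with discount factors greater than one, the second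
of which has an initial state. -/
def Accepts (x : NDACode × NDACode) (w : Witness) : Prop :=
  Proper x.1.1 ∧ Proper x.2.1 ∧ ¬ x.2.2.2.1 = [] →
    (w.1.1 = some none ∧ ¬ Starts x.1 ∧ (w.1.2 = true → Starts x.2) ∧
      (Starts x.2 → w.1.2 = true)) ∨
    (w.1.1 = none ∧ w.1.2 = true ∧ ∃ y ∈ (product x).walks w.2.1.2, Stuck x y.1) ∨
    (¬ (fracOf w.1.1).2 = 0 ∧
      CodedGraph.certF (product x) (Fr.ofFrac (fracOf w.1.1)) w.1.2 w.2.1.1 w.2.1.2 w.2.2 ∧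
      ∀ c ∈ w.2.2, ¬ Stuck x c.1)

section Primrec

open Primrec

theorem primrecPred_proper : PrimrecPred Proper :=
  .and (nat_lt.comp (.const 0) snd) (nat_lt.comp snd (Fr.primrec_toNat.comp fst))

theorem primrec_invF : Primrec invF :=
  snd.pair (Primrec.pair (.const 0) (Primrec.pred.comp (Fr.primrec_toNat.comp fst)))

theorem primrec_product : Primrec product := by
  have hA : Primrec fun x : NDACode × NDACode => x.1 := fst
  have hD : Primrec fun x : NDACode × NDACode => x.2 := snd
  have hiA := fst.comp (snd.comp (snd.comp hA))
  have hiD := fst.comp (snd.comp (snd.comp hD))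
  have htA := snd.comp (snd.comp (snd.comp hA))
  have htD := snd.comp (snd.comp (snd.comp hD))
  have h1 : Primrec fun t : ((NDACode × NDACode) × ℕ) × ℕ => (t.1.2, t.2) :=
    (snd.comp fst).pair snd
  let T := ((NDACode × NDACode) × (ℕ × ℕ × ℕ) × ℤ × ℕ) × (ℕ × ℕ × ℕ) × ℤ × ℕ
  have hs : Primrec fun t : T => t.1.2 := snd.comp fst
  have ht : Primrec fun t : T => t.2 := snd
  have h2 : Primrec fun t : T =>
      if t.1.2.1.2.1 = t.2.1.2.1 then
        some ((t.1.2.1.1, t.2.1.1), (t.1.2.1.2.2, t.2.1.2.2),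
          (Fr.ofFrac t.1.2.2, Fr.ofFrac t.2.2))
      else none :=
    Primrec.ite (.eq_of (fst.comp (snd.comp (fst.comp hs))) (fst.comp (snd.comp (fst.comp ht))))
      (option_some.comp (((fst.comp (fst.comp hs)).pair (fst.comp (fst.comp ht))).pair
        (((snd.comp (snd.comp (fst.comp hs))).pair (snd.comp (snd.comp (fst.comp ht)))).pair
          ((Fr.primrec_ofFrac.comp (snd.comp hs)).pair (Fr.primrec_ofFrac.comp (snd.comp ht))))))
      (.const none)
  exact ((primrec_invF.comp (fst.comp hA)).pair (primrec_invF.comp (fst.comp hD))).pair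
    ((list_flatMap hiA (list_map (hiD.comp fst) h1.to₂).to₂).pair
      (list_flatMap htA (listFilterMap (htD.comp fst) h2.to₂).to₂))

variable {τ : Type*} [Primcodable τ]

theorem primrecPred_stuck {x : τ → NDACode × NDACode} {s : τ → PairState} (hx : Primrec x)
    (hs : Primrec s) : PrimrecPred fun t => Stuck (x t) (s t) := by
  have htA := snd.comp (snd.comp (snd.comp (fst.comp hx)))
  have htD := snd.comp (snd.comp (snd.comp (snd.comp hx)))
  let T := (τ × (ℕ × ℕ × ℕ) × ℤ × ℕ) × (ℕ × ℕ × ℕ) × ℤ × ℕ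
  have he : Primrec fun t : T => t.1.2 := snd.comp fst
  have ht : Primrec fun t : T => t.2 := snd
  exact .bex htA (.and (.eq_of (fst.comp (fst.comp snd)) (fst.comp (hs.comp fst)))
    (.ball (htD.comp fst) (.imp
      (.eq_of (fst.comp (fst.comp ht)) (snd.comp (hs.comp (fst.comp fst))))
      (PrimrecPred.eq_of (fst.comp (snd.comp (fst.comp he)))
        (fst.comp (snd.comp (fst.comp ht)))).not)))

theorem primrecPred_forall_not_stuck {x : τ → NDACode × NDACode} {C : τ → List CodedNode}
    (hx : Primrec x) (hC : Primrec C) : PrimrecPred fun t => ∀ c ∈ C t, ¬ Stuck (x t) c.1 :=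
  .ball hC (primrecPred_stuck (hx.comp fst) (fst.comp snd)).not

theorem primrecPred_starts {c : τ → NDACode} (hc : Primrec c) :
    PrimrecPred fun t => Starts (c t) :=
  .bex (fst.comp (snd.comp (snd.comp hc))) (.bex (snd.comp (snd.comp (snd.comp (hc.comp fst))))
    (.eq_of (fst.comp (fst.comp snd)) (snd.comp fst)))

theorem primrecPred_accepts :
    PrimrecPred fun t : (ℕ × NDACode × NDACode) × Witness => Accepts t.1.2 t.2 := by
  have hx : Primrec fun t : (ℕ × NDACode × NDACode) × Witness => t.1.2 := snd.comp fst
  have ho : Primrec fun t : (ℕ × NDACode × NDACode) × Witness => t.2.1.1 := fst.comp (fst.comp snd)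
  have hatt : Primrec fun t : (ℕ × NDACode × NDACode) × Witness => t.2.1.2 :=
    snd.comp (fst.comp snd)
  have hN : Primrec fun t : (ℕ × NDACode × NDACode) × Witness => t.2.2.1.1 :=
    fst.comp (fst.comp (snd.comp snd))
  have hK : Primrec fun t : (ℕ × NDACode × NDACode) × Witness => t.2.2.1.2 :=
    snd.comp (fst.comp (snd.comp snd))
  have hC : Primrec fun t : (ℕ × NDACode × NDACode) × Witness => t.2.2.2 := snd.comp (snd.comp snd)
  have hG : Primrec fun t : (ℕ × NDACode × NDACode) × Witness => product t.1.2 :=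
    primrec_product.comp hx
  have hf : Primrec fun t : (ℕ × NDACode × NDACode) × Witness => fracOf t.2.1.1 :=
    option_getD.comp (option_getD.comp ho (.const none)) (.const (0, 0))
  refine .imp (.and (primrecPred_proper.comp (fst.comp (fst.comp hx)))
    (.and (primrecPred_proper.comp (fst.comp (snd.comp hx))) (PrimrecPred.eq_of
      (fst.comp (snd.comp (snd.comp (snd.comp hx)))) (.const [])).not)) (.or ?_ (.or ?_ ?_))
  · exact .and (.eq_of ho (.const (some none))) (.and (primrecPred_starts (fst.comp hx)).not
      (.and (.imp (.eq_of hatt (.const true)) (primrecPred_starts (snd.comp hx)))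
        (.imp (primrecPred_starts (snd.comp hx)) (.eq_of hatt (.const true)))))
  · exact .and (.eq_of ho (.const none)) (.and (.eq_of hatt (.const true))
      (.bex (CodedGraph.primrec_walks.comp hG hK)
        (primrecPred_stuck (hx.comp fst) (fst.comp snd))))
  · exact .and (PrimrecPred.eq_of (snd.comp hf) (.const 0)).not
      (.and (CodedGraph.primrecPred_certF hG (Fr.primrec_ofFrac.comp hf) hatt hN hK hC)
        (primrecPred_forall_not_stuck hx hC))

end Primrec

theorem product_finite (x : NDACode × NDACode) :
    (product x).toGraph.init.Finite ∧ (product x).toGraph.edge.Finite :=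
  ⟨(product x).2.1.finite_toSet, (product x).2.2.finite_toSet.image _⟩

theorem exists_list_image_val {C : Set (PairState × (ℚ × ℚ) × Bool)} (hC : C.Finite) :
    ∃ l : List CodedNode, CodedNode.val '' {c | c ∈ l} = C := by
  have hsurj : Function.Surjective CodedNode.val := fun ⟨s, c, b⟩ => by
    obtain ⟨y, hy⟩ := FrPair.exists_val_eq c
    exact ⟨(s, y, b), by rw [CodedNode.val, hy]⟩
  choose g hg using hsurj
  refine ⟨hC.toFinset.toList.map g, ?_⟩
  ext c
  simp only [List.mem_map, Finset.mem_toList, Set.Finite.mem_toFinset, Set.mem_image,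
    Set.mem_ofPred_eq]
  constructor
  · rintro ⟨_, ⟨d, hd, rfl⟩, rfl⟩
    rwa [hg]
  · intro hc
    exact ⟨g c, ⟨c, hc, rfl⟩, hg c⟩

/-- Every input has an accepted witness, so that the search terminates. -/
theorem exists_accepts (x : NDACode × NDACode) : ∃ w, Accepts x w := by
  classical
  by_cases hv : Proper x.1.1 ∧ Proper x.2.1 ∧ ¬ x.2.2.2.1 = []
  swap
  · exact ⟨((none, true), (0, 0), []), fun h => absurd h hv⟩
  by_cases hs : Starts x.1
  swap
  · exact ⟨((some none, decide (Starts x.2)), (0, 0), []),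
      fun _ => Or.inl ⟨rfl, hs, of_decide_eq_true, decide_eq_true⟩⟩
  by_cases hst : ∃ k, ∃ y ∈ (product x).walks k, Stuck x y.1
  · obtain ⟨k, hk⟩ := hst
    exact ⟨((none, true), (0, k), []), fun _ => Or.inr (Or.inl ⟨rfl, rfl, hk⟩)⟩
  push Not at hst
  obtain ⟨hA, hD, hne⟩ := hv
  have hα : 0 < (product x).toGraph.α := hA.invF_pos
  have hβ : 0 < (product x).toGraph.β := hD.invF_pos
  have hlive : ∀ {k s y}, (product x).toGraph.Walk k s y → ¬ Stuck x s := fun {k s y} h => by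
    obtain ⟨z, hz, -⟩ := ((product x).walk_iff k s y).1 h
    exact hst k _ hz
  have hone : ∃ s y, (product x).toGraph.Walk 1 s y := by
    obtain ⟨p, hp, e, he, rfl⟩ := hs
    obtain ⟨q, hq⟩ := List.exists_mem_of_ne_nil _ hne
    have hstart : (product x).toGraph.Walk 0 (e.1.1, q) 0 :=
      .start (List.mem_flatMap.2 ⟨_, hp, List.mem_map.2 ⟨q, hq, rfl⟩⟩)
    have hns := hlive hstart
    simp only [Stuck, not_exists, not_and, not_forall, not_not] at hns
    obtain ⟨t, ht, h1, h2⟩ := hns e he rfl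
    refine ⟨_, _, hstart.step ⟨((e.1.1, t.1.1), (e.1.2.2, t.1.2.2),
      (Fr.ofFrac e.2, Fr.ofFrac t.2)), ?_, by simp only [h1]; rfl⟩⟩
    exact List.mem_flatMap.2 ⟨e, he, List.mem_filterMap.2 ⟨t, ht, by simp [h2]⟩⟩
  obtain ⟨v, att, N, C, hC, hreach, hcert⟩ := CostGraph.exists_isCertificate (product_finite x).1
    (product_finite x).2 hα hA.invF_lt_one hβ hD.invF_lt_one hone
  obtain ⟨l, rfl⟩ := exists_list_image_val hC
  have hval : (Fr.ofFrac (v.num, v.den)).val = v := by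
    rw [Fr.val_ofFrac v.den_nz, Rat.num_div_den]
  rw [← hval] at hcert
  obtain ⟨K, hK⟩ := (CodedGraph.exists_certF_iff _ hα hβ _ _ _ _).2 hcert
  refine ⟨((some (some (v.num, v.den)), att), (N, K), l), fun _ => Or.inr (Or.inr
    ⟨v.den_nz, hK, fun c hc => ?_⟩)⟩
  obtain ⟨k, y, hw⟩ := hreach _ ⟨c, hc, rfl⟩
  exact hlive hw

end NDACode

namespace NDA

open NDACode

variable {m n k : ℕ} {A : NDA (Fin m) (Fin n)} {D : NDA (Fin m) (Fin k)}

theorem mem_code_init {i : ℕ} : i ∈ A.code.2.2.1 ↔ ∃ q ∈ A.init, i = (q : ℕ) := by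
  simp [code]

theorem mem_code_trans {e : (ℕ × ℕ × ℕ) × (ℤ × ℕ)} : e ∈ A.code.2.2.2 ↔
    ∃ (p : Fin n) (a : Fin m) (q : Fin n) (h : (p, a, q) ∈ A.trans),
      e = (((p : ℕ), (a : ℕ), (q : ℕ)), ratCode (A.weight ⟨_, h⟩)) := by
  simp only [code, List.mem_filterMap, List.mem_product, List.mem_finRange, true_and, Prod.exists]
  constructor
  · rintro ⟨p, a, q, h⟩
    split_ifs at h with ht
    exact ⟨p, a, q, ht, (Option.some_inj.1 h).symm⟩
  · rintro ⟨p, a, q, ht, rfl⟩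
    exact ⟨p, a, q, by rw [dif_pos ht]⟩

theorem starts_code : Starts A.code ↔ ∃ p ∈ A.init, ∃ a p', (p, a, p') ∈ A.trans := by
  simp only [Starts, mem_code_init, mem_code_trans]
  constructor
  · rintro ⟨_, ⟨q, hq, rfl⟩, _, ⟨p, a, p', h, rfl⟩, heq⟩
    obtain rfl := Fin.ext heq
    exact ⟨p, hq, a, p', h⟩
  · rintro ⟨p, hp, a, p', h⟩
    exact ⟨_, ⟨p, hp, rfl⟩, _, ⟨p, a, p', h, rfl⟩, rfl⟩

theorem stuck_code {p : Fin n} {q : Fin k} :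
    Stuck (A.code, D.code) ((p : ℕ), (q : ℕ)) ↔
      ∃ a p', (p, a, p') ∈ A.trans ∧ ∀ q', (q, a, q') ∉ D.trans := by
  simp only [Stuck, mem_code_trans]
  constructor
  · rintro ⟨_, ⟨p₁, a, p', h, rfl⟩, heq, hst⟩
    obtain rfl := Fin.ext heq
    exact ⟨a, p', h, fun q' hq' => hst _ ⟨q, a, q', hq', rfl⟩ rfl rfl⟩
  · rintro ⟨a, p', h, hst⟩
    refine ⟨_, ⟨p, a, p', h, rfl⟩, rfl, ?_⟩
    rintro _ ⟨q₁, b, q', hq', rfl⟩ heq hab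
    obtain rfl := Fin.ext heq
    obtain rfl := Fin.ext hab
    exact hst q' hq'

theorem isProduct_code : IsProduct A D (product (A.code, D.code)).toGraph where
  α_eq := val_invF_ratCode A.one_lt_discount
  β_eq := val_invF_ratCode D.one_lt_discount
  mem_init s := by
    refine List.mem_flatMap.trans ?_
    simp only [mem_code_init, List.mem_map]
    constructor
    · rintro ⟨_, ⟨p, hp, rfl⟩, _, ⟨q, hq, rfl⟩, rfl⟩
      exact ⟨p, hp, q, hq, rfl⟩
    · rintro ⟨p, hp, q, hq, rfl⟩
      exact ⟨_, ⟨p, hp, rfl⟩, _, ⟨q, hq, rfl⟩, rfl⟩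
  mem_edge e := by
    have hval : ∀ q : ℚ, (Fr.ofFrac (ratCode q)).val = q := fun q => by
      rw [ratCode, Fr.val_ofFrac q.den_nz, Rat.num_div_den]
    constructor
    · rintro ⟨f, hf, rfl⟩
      obtain ⟨s, hs, hf⟩ := List.mem_flatMap.1 hf
      obtain ⟨t, ht, hf⟩ := List.mem_filterMap.1 hf
      obtain ⟨p, a, p', hA, rfl⟩ := mem_code_trans.1 hs
      obtain ⟨q, b, q', hD, rfl⟩ := mem_code_trans.1 ht
      split_ifs at hf with hab
      obtain rfl := Fin.ext hab
      obtain rfl := Option.some_inj.1 hf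
      exact ⟨p, q, a, p', q', hA, hD, by simp only [FrPair.val, hval]⟩
    · rintro ⟨p, q, a, p', q', hA, hD, rfl⟩
      refine ⟨_, List.mem_flatMap.2 ⟨_, mem_code_trans.2 ⟨p, a, p', hA, rfl⟩,
        List.mem_filterMap.2 ⟨_, mem_code_trans.2 ⟨q, a, q', hD, rfl⟩, if_pos rfl⟩⟩, ?_⟩
      simp only [FrPair.val, hval]

/-- On the descriptions of automata, every accepted witness holds the right answer. -/
theorem accepts_sound (hD : D.IsDeterministic) {w : Witness}
    (hw : Accepts (A.code, D.code) w) :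
    Denotes w.1.1 (sInf (A.diffSet D)) ∧
      (w.1.2 = true ↔ ∃ x ∈ A.diffSet D, x = sInf (A.diffSet D)) := by
  obtain ⟨⟨out, att⟩, ⟨N, K⟩, C⟩ := w
  have hH : IsProduct A D (product (A.code, D.code)).toGraph := isProduct_code
  have hinit : ¬ D.code.2.2.1 = [] := by
    obtain ⟨q, hq, -⟩ := hD.1
    exact List.ne_nil_of_mem (mem_code_init.2 ⟨q, hq, rfl⟩)
  rcases hw ⟨proper_ratCode A.one_lt_discount, proper_ratCode D.one_lt_discount, hinit⟩ with
    ⟨h1, h2, h3, h4⟩ | ⟨h1, h2, y, hy, hst⟩ | ⟨h1, h2, h3⟩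
  -- The answer `⊤`.
  · rw [starts_code] at h2
    obtain rfl : out = some none := h1
    have htop : sInf (A.diffSet D) = ⊤ :=
      sInf_eq_top.2 fun x hx => eq_top_of_mem_diffSet hD h2 hx
    have hatt : att = true ↔ (A.diffSet D).Nonempty := by
      rw [diffSet_nonempty_iff h2, ← starts_code]
      exact ⟨h3, h4⟩
    refine ⟨htop, hatt.trans ⟨fun ⟨x, hx⟩ => ⟨x, hx, ?_⟩, fun ⟨x, hx, _⟩ => ⟨x, hx⟩⟩⟩
    rw [htop, eq_top_of_mem_diffSet hD h2 hx]
  -- The answer `⊥`: the word of the walk to the stuck pair, extended by one letter.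
  · obtain rfl : out = none := h1
    obtain rfl : att = true := h2
    obtain ⟨u, p, q, y', z, hyA, hzD, -, hs, -⟩ :=
      hH.walk_iff.1 (((product (A.code, D.code)).walk_iff _ _ _).2 ⟨_, hy, rfl⟩)
    rw [hs, stuck_code] at hst
    obtain ⟨a, p', hA, hq⟩ := hst
    have hmem := bot_mem_diffSet hD hyA hzD hA hq
    have hbot : sInf (A.diffSet D) = ⊥ := le_bot_iff.1 (sInf_le hmem)
    exact ⟨hbot, by simpa [hbot] using hmem⟩
  -- A finite answer: the entries of the certificate cover all reachable pairs and are not stuck.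
  · obtain ⟨a, b, hout, hb⟩ : ∃ a b, out = some (some (a, b)) ∧ b ≠ 0 := by
      rcases out with _ | _ | ⟨a, b⟩
      · exact absurd rfl h1
      · exact absurd rfl h1
      · exact ⟨a, b, rfl, h1⟩
    subst hout
    have hpA := proper_ratCode A.one_lt_discount
    have hpD := proper_ratCode D.one_lt_discount
    have hα : 0 < (product (A.code, D.code)).toGraph.α := hpA.invF_pos
    have hβ : 0 < (product (A.code, D.code)).toGraph.β := hpD.invF_pos
    have hcert := (CodedGraph.exists_certF_iff _ hα hβ _ _ _ _).1 ⟨K, h2⟩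
    have hv : (Fr.ofFrac (fracOf (some (some (a, b))))).val = a / b := Fr.val_ofFrac hb
    simp only [hv] at hcert
    set v : ℚ := a / b with hvdef
    have hlive : ∀ (p : Fin n) (q : Fin k) l x,
        (product (A.code, D.code)).toGraph.Walk l ((p : ℕ), (q : ℕ)) x → ∀ a p',
        (p, a, p') ∈ A.trans → ∃ q', (q, a, q') ∈ D.trans := by
      intro p q l x hwalk a p' hA
      obtain ⟨_, ⟨c, hc, rfl⟩, heq⟩ := hcert.exists_mem_of_walk hwalk
      by_contra! hcon
      exact h3 c hc ((show c.1 = _ from heq) ▸ stuck_code.2 ⟨a, p', hA, hcon⟩)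
    have hlow : ∀ y ∈ A.diffSet D, ((v : ℝ) : EReal) ≤ y ∧
        (att = false → ((v : ℝ) : EReal) < y) := by
      intro y hy
      rcases hH.exists_walk_of_mem_diffSet hD hlive hy with rfl | ⟨l, hl, s, x, hwalk, rfl⟩
      · exact ⟨le_top, fun _ => EReal.coe_lt_top _⟩
      · obtain ⟨h, h'⟩ := hcert.le_of_walk hl hwalk
        exact ⟨by exact_mod_cast h, fun ha => by exact_mod_cast h' ha⟩
    have hinf : sInf (A.diffSet D) = ((v : ℝ) : EReal) := by
      refine le_antisymm (le_of_not_gt fun hlt => ?_) (le_sInf fun y hy => (hlow y hy).1)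
      obtain ⟨r, hr1, hr2⟩ := EReal.lt_iff_exists_rat_btwn.1 hlt
      have hr : v < r := by exact_mod_cast hr1
      obtain ⟨l, hl, s, x, hwalk, hx⟩ := hcert.exists_walk_lt
        ((List.finite_toSet C).image _) hα hpA.invF_lt_one hβ
        hpD.invF_lt_one (sub_pos.2 hr)
      obtain ⟨y, hy, hyx⟩ := hH.exists_mem_diffSet_le hD hl hwalk
      rw [add_sub_cancel] at hx
      have hxr : ((x : ℝ) : EReal) < ((r : ℝ) : EReal) := by exact_mod_cast hx
      exact absurd (hr2.trans_le (sInf_le hy)) (not_lt.2 (hyx.trans hxr.le))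
    refine ⟨⟨hb, ?_⟩, ?_⟩
    · rw [hinf, hvdef]
      push_cast
      rfl
    · rw [hinf]
      constructor
      · intro ha
        obtain ⟨l, hl, s, x, hwalk, hx⟩ := hcert.attained ha
        obtain ⟨y, hy, hyx⟩ := hH.exists_mem_diffSet_le hD hl hwalk
        have hxv : ((x : ℝ) : EReal) ≤ ((v : ℝ) : EReal) := by exact_mod_cast hx
        exact ⟨y, hy, le_antisymm (hyx.trans hxv) (hlow y hy).1⟩
      · rintro ⟨y, hy, rfl⟩
        by_contra ha
        exact lt_irrefl _ ((hlow _ hy).2 (by simpa using ha))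

end NDA

/-- One algorithm computes, from the alphabet size and the descriptions of a `λ_A`-NDA `A` and a
`λ_D`-DDA `D`, the infimum of `A(u) - D(u)` over the nonempty finite words `u`, and determines
whether some word attains it. -/
theorem mainTheorem8 :
    ∃ f : ℕ × NDACode × NDACode → Option (Option (ℤ × ℕ)) × Bool,
      Computable f ∧
      ∀ (m nA nD : ℕ) (A : NDA (Fin m) (Fin nA)) (D : NDA (Fin m) (Fin nD)),
        D.IsDeterministic →
        Denotes (f (m, A.code, D.code)).1 (sInf (A.diffSet D)) ∧
        ((f (m, A.code, D.code)).2 = true ↔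
          ∃ x ∈ A.diffSet D, x = sInf (A.diffSet D)) := by
  obtain ⟨g, hg, hacc⟩ := exists_computable_of_certificate NDACode.primrecPred_accepts
    fun a => NDACode.exists_accepts a.2
  exact ⟨fun a => (g a).1, Computable.fst.comp hg, fun m nA nD A D hD =>
    NDA.accepts_sound hD (hacc (m, A.code, D.code))⟩
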